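/- Let $\Theta\subseteq\mathbb{R}^k$ be open and let $\{p_\theta:\theta\in\Theta\}$ be probability densities with respect to a measure $\mu$, with distributions $P_\theta$; write $P_\theta^n$ for the law of $n$ i.i.d. observations and $\ell(\theta)=\sum_{i\le n}\log p_\theta(X_i)$. Suppose the model is doubly differentiable in quadratic mean (DDQM) at $\theta\in\Theta$: there are measurable score functions $\dot\ell_{\theta'}$ such that for all sequences $h,\tilde h\to0$, $$\int\Bigl(\sqrt{p_{\theta+h}}-\sqrt{p_{\theta+\tilde h}}-\tfrac12(h-\tilde h)^T\dot\ell_{\theta+\tilde h}\sqrt{p_{\theta+\tilde h}}\Bigr)^2d\mu=o(\|h-\tilde h\|^2).$$ Let $\mathcal M_1,\mathcal M_2\subseteq\Theta$ and $c>0$. For $\theta\in\mathcal M_1\cap\mathcal M_2$ let $D_\varepsilon$ be the Hausdorff distance between $\mathcal M_1\cap N_\varepsilon(\theta)$ and $\mathcal M_2\cap N_\varepsilon(\theta)$, where $N_\varepsilon(\theta)$ is the $\varepsilon$-ball around $\theta$. The models are $c$-equivalent at $\theta$ if $D_\varepsilon=o(\varepsilon^c)$, and $c$-near-equivalent at $\theta$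 if $D_\varepsilon=O(\varepsilon^c)$, as $\varepsilon\downarrow0$. Say that $\mathcal M_1,\mathcal M_2$ cannot be asymptotically distinguished under local alternatives to $\theta$ of order $O(r_n)$ (respectively $o(r_n)$) if for every sequence $h_n=O(r_n)$ (respectively $o(r_n)$) with $\theta+h_n\in\mathcal M_1$ for all $n$ there is a sequence $\tilde h_n$ of the same order with $\theta+\tilde h_n\in\mathcal M_2$ for all $n$ such that (i) $E_{P_{\theta+h_n}^n}\varphi_n-E_{P_{\theta+\tilde h_n}^n}\varphi_n\to0$ for every sequence of tests $\varphi_n$ (measurable $[0,1]$-valued functions of $n$ observations), and (ii) $\ell(\theta+h_n)-\ell(\theta+\tilde h_n)\to0$ in $P_{\theta+\tilde h_n}^n$-probability; and if the same holds with $\mathcal M_1$ and $\mathcal M_2$ exchanged. Then: 1. If $\mathcal M_1,\mathcal M_2$ are $c$-equivalent at $\theta$, they cannot be asymptotically distinguished under local alternatives to $\theta$ of order $O(n^{-1/(2c)})$. 2. If $\mathcal M_1,\mathcal M_2$ are $c$-near-equivalent at $\theta$, they cannot be asymptotically distinguished under local alternatives to $\theta$ of order $o(n^{-1/(2c)})$.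 3. For example, if $\mathcal M_1,\mathcal M_2$ are 1-equivalent at $\theta$ and near $\theta$ both are twice continuously differentiable embedded submanifolds of $\mathbb R^k$, they cannot be asymptotically distinguished under local alternatives to $\theta$ of order $o(n^{-1/4})$; that is, effects of order $n^{-1/4}$ or larger are required. -/

import Mathlib

open Filter Topology MeasureTheory Asymptotics

/-- A dominated parametric statistical model: an open parameter set `Θ ⊆ ℝᵏ` and, for every
`θ ∈ Θ`, a probability density `p_θ` with respect to a common measure `μ` on the sample space. -/
structure DominatedModel (k : ℕ) (X : Type*) [MeasurableSpace X] where
  Θ : Set (EuclideanSpace ℝ (Fin k))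
  isOpen_Θ : IsOpen Θ
  μ : Measure X
  density : EuclideanSpace ℝ (Fin k) → X → ℝ
  measurable_density : ∀ θ ∈ Θ, Measurable (density θ)
  density_nonneg : ∀ θ ∈ Θ, ∀ x, 0 ≤ density θ x
  lintegral_density : ∀ θ ∈ Θ, ∫⁻ x, ENNReal.ofReal (density θ x) ∂μ = 1

namespace DominatedModel

variable {k : ℕ} {X : Type*} [MeasurableSpace X]

/-- The distribution `P_θ` of one observation. -/
noncomputable def law (m : DominatedModel k X) (θ : EuclideanSpace ℝ (Fin k)) : Measure X :=
  m.μ.withDensity fun x => ENNReal.ofReal (m.density θ x)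

/-- The joint distribution of `n` independent observations from `P_θ`. -/
noncomputable def sampleLaw (m : DominatedModel k X) (n : ℕ) (θ : EuclideanSpace ℝ (Fin k)) :
    Measure (Fin n → X) :=
  Measure.pi fun _ => m.law θ

/-- The log-likelihood of a sample of size `n` (meaningful where all densities are positive). -/
noncomputable def logLik (m : DominatedModel k X) {n : ℕ} (θ : EuclideanSpace ℝ (Fin k))
    (x : Fin n → X) : ℝ :=
  ∑ i, Real.log (m.density θ (x i))

/-- The integrand in the definition of double differentiability in quadratic mean:
`(√p_{θ+h} - √p_{θ+h'} - ½ (h - h')ᵀ s(θ + h') √p_{θ+h'})²`, where `s` is the score. -/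
noncomputable def ddqmRemainder (m : DominatedModel k X)
    (s : EuclideanSpace ℝ (Fin k) → X → EuclideanSpace ℝ (Fin k))
    (θ h h' : EuclideanSpace ℝ (Fin k)) (x : X) : ℝ :=
  (Real.sqrt (m.density (θ + h) x) - Real.sqrt (m.density (θ + h') x)
    - 1 / 2 * inner ℝ (h - h') (s (θ + h') x) * Real.sqrt (m.density (θ + h') x)) ^ 2

/-- The model is doubly differentiable in quadratic mean at `θ ∈ Θ`. -/
def DDQMAt (m : DominatedModel k X) (θ : EuclideanSpace ℝ (Fin k)) : Prop :=
  θ ∈ m.Θ ∧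
  ∃ s : EuclideanSpace ℝ (Fin k) → X → EuclideanSpace ℝ (Fin k),
    (∀ θ' ∈ m.Θ, Measurable (s θ')) ∧
    ∀ h h' : ℕ → EuclideanSpace ℝ (Fin k),
      Tendsto h atTop (𝓝 0) → Tendsto h' atTop (𝓝 0) →
        (∀ᶠ n in atTop, Integrable (m.ddqmRemainder s θ (h n) (h' n)) m.μ) ∧
        (fun n => ∫ x, m.ddqmRemainder s θ (h n) (h' n) x ∂m.μ)
          =o[atTop] fun n => ‖h n - h' n‖ ^ 2

/-- Two sequences of parameter values, `n` being the sample size, are asymptotically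
indistinguishable: no sequence of (randomized) tests `φ n` based on `n` independent observations
has rejection probabilities under the two sequences that stay apart, and the difference of the
log-likelihoods tends to zero in probability under the second sequence (with probability tending
to one, both log-likelihoods are finite and they differ by less than `δ`). -/
def AsympIndistinguishable (m : DominatedModel k X)
    (θ₁ θ₂ : ℕ → EuclideanSpace ℝ (Fin k)) : Prop :=
  (∀ φ : (n : ℕ) → (Fin n → X) → ℝ,
    (∀ n, Measurable (φ n)) → (∀ n x, φ n x ∈ Set.Icc (0 : ℝ) 1) →
      Tendsto (fun n => ∫ x, φ n x ∂(m.sampleLaw n (θ₁ n)) - ∫ x, φ n x ∂(m.sampleLaw n (θ₂ n)))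
        atTop (𝓝 0)) ∧
  (∀ δ : ℝ, 0 < δ →
    Tendsto
      (fun n => m.sampleLaw n (θ₂ n)
        {x | (∀ i, 0 < m.density (θ₁ n) (x i) ∧ 0 < m.density (θ₂ n) (x i)) ∧
          |m.logLik (θ₁ n) x - m.logLik (θ₂ n) x| < δ})
      atTop (𝓝 1))

/-- Every sequence of local alternatives `θ + h_n` in `A` whose deviations have the given order is
asymptotically indistinguishable from some sequence of local alternatives in `B` whose deviations
have that order too. -/
def LocallyMimicked (m : DominatedModel k X) (A B : Set (EuclideanSpace ℝ (Fin k)))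
    (θ : EuclideanSpace ℝ (Fin k)) (order : (ℕ → EuclideanSpace ℝ (Fin k)) → Prop) : Prop :=
  ∀ h : ℕ → EuclideanSpace ℝ (Fin k), order h → (∀ n, θ + h n ∈ A) →
    ∃ h' : ℕ → EuclideanSpace ℝ (Fin k), order h' ∧ (∀ n, θ + h' n ∈ B) ∧
      m.AsympIndistinguishable (fun n => θ + h n) (fun n => θ + h' n)

/-- The submodels `A` and `B` cannot be asymptotically distinguished under local alternatives to
`θ` of the given order, whichever of the two submodels is the true one. -/
def CannotDistinguish (m : DominatedModel k X) (A B : Set (EuclideanSpace ℝ (Fin k)))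
    (θ : EuclideanSpace ℝ (Fin k)) (order : (ℕ → EuclideanSpace ℝ (Fin k)) → Prop) : Prop :=
  m.LocallyMimicked A B θ order ∧ m.LocallyMimicked B A θ order

end DominatedModel

/-- `A` and `B` are `c`-equivalent at `θ ∈ A ∩ B`: the Hausdorff distance of their traces on the
`ε`-ball around `θ` is `o(ε^c)`. (Both traces contain `θ`, so this distance is finite.) -/
def CEquivalentAt {k : ℕ} (c : ℝ) (A B : Set (EuclideanSpace ℝ (Fin k)))
    (θ : EuclideanSpace ℝ (Fin k)) : Prop :=
  θ ∈ A ∩ B ∧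
  Tendsto
    (fun ε : ℝ => ε ^ (-c) * Metric.hausdorffDist (A ∩ Metric.ball θ ε) (B ∩ Metric.ball θ ε))
    (𝓝[>] 0) (𝓝 0)

/-- `A` and `B` are `c`-near-equivalent at `θ ∈ A ∩ B`: the same distance is `O(ε^c)`. -/
def CNearEquivalentAt {k : ℕ} (c : ℝ) (A B : Set (EuclideanSpace ℝ (Fin k)))
    (θ : EuclideanSpace ℝ (Fin k)) : Prop :=
  θ ∈ A ∩ B ∧
  (fun ε : ℝ => Metric.hausdorffDist (A ∩ Metric.ball θ ε) (B ∩ Metric.ball θ ε))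
    =O[𝓝[>] 0] fun ε : ℝ => ε ^ c

/-- Near its point `θ`, the set `A` is a twice continuously differentiable embedded submanifold
of `ℝᵏ`: a level set of a `C²` map that is a submersion at `θ`. -/
def IsC2SubmanifoldAt {k : ℕ} (A : Set (EuclideanSpace ℝ (Fin k)))
    (θ : EuclideanSpace ℝ (Fin k)) : Prop :=
  θ ∈ A ∧
  ∃ (q : ℕ) (U : Set (EuclideanSpace ℝ (Fin k)))
    (g : EuclideanSpace ℝ (Fin k) → EuclideanSpace ℝ (Fin q)),
    IsOpen U ∧ θ ∈ U ∧ ContDiffOn ℝ 2 g U ∧ Function.Surjective (fderiv ℝ g θ) ∧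
      A ∩ U = {x ∈ U | g x = 0}

/-! The statistical part rests on the squared Hellinger distance `H = ∫ (√p₁ - √p₂)² dμ` of one
observation. Let `W = √(p₁/p₂) - 1`. Under `P_{θ₂}` one has `E W = -H/2` and `E W² ≤ H`. If `n H →
0`, then `∑ Wᵢ → 0` by Chebyshev and `∑ Wᵢ² → 0` by Markov, so the log-likelihood ratio `2 ∑ log (1
+ Wᵢ)` tends to 0 in probability. Where it is below `δ` in absolute value, the first sample law
dominates `e^{-δ}` times the second, so no test separates the two
(`asympIndistinguishable_of_hellingerSq`).

DDQM makes `θ ↦ √p_θ` Lipschitz into `L²(μ)` near `θ`, whence `H ≤ C ‖h - h'‖²`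
(`DDQMAt.exists_hellingerSq_le`). It therefore suffices to find `h'` in the other model with `h - h'
= o(n^{-1/2})`.

For (near-)equivalent models, compare traces on balls of radius just above `‖h n‖`: with `r =
n^{-1/(2c)}` the Hausdorff distance is `o(r^c) = o(n^{-1/2})`. For `C²` submanifolds, 1-equivalence
forces the tangent spaces at `θ` to agree. A defining map of one model is then `O(‖h‖²)` along the
other, and since its derivative is onto, it has a zero within `O(‖h‖²)`, which is `o(n^{-1/2})` for
`h = o(n^{-1/4})`. -/

section HellingerBounds

open ProbabilityTheory

/-! ### Product densities, tests and a logarithm bound -/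

/-- A product of probability measures with densities is the product measure with the product
density. -/
theorem pi_withDensity_eq {ι X : Type*} [Fintype ι] [MeasurableSpace X] (Q : Measure X)
    [IsProbabilityMeasure Q] {L : X → ENNReal} (hL : Measurable L)
    [SigmaFinite (Q.withDensity L)] :
    (Measure.pi fun _ : ι => Q.withDensity L)
      = (Measure.pi fun _ : ι => Q).withDensity fun x => ∏ i, L (x i) := by
  refine Measure.pi_eq fun s hs => ?_
  rw [withDensity_apply _ (MeasurableSet.univ_pi hs),
    ← lintegral_indicator (MeasurableSet.univ_pi hs)]
  -- On a box the indicator splits into coordinate indicators, and independence of the coordinates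
  -- factors the integral.
  have hind : iIndepFun (fun i (x : ι → X) => (s i).indicator L (x i))
      (Measure.pi fun _ : ι => Q) :=
    iIndepFun_pi fun i => (hL.indicator (hs i)).aemeasurable
  have h := lintegral_prod_eq_prod_lintegral_of_indepFun Finset.univ
    (fun i (x : ι → X) => (s i).indicator L (x i)) hind
    (fun i => (hL.indicator (hs i)).comp (measurable_pi_apply i))
  calc _ = ∫⁻ x : ι → X, ∏ i, (s i).indicator L (x i) ∂(Measure.pi fun _ : ι => Q) := by
        refine lintegral_congr fun x => ?_
        by_cases hx : x ∈ Set.univ.pi s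
        · rw [Set.indicator_of_mem hx]
          exact Finset.prod_congr rfl fun i _ =>
            (Set.indicator_of_mem (hx i (Set.mem_univ i)) _).symm
        · rw [Set.indicator_of_notMem hx]
          simp only [Set.mem_univ_pi, not_forall] at hx
          obtain ⟨i, hi⟩ := hx
          exact (Finset.prod_eq_zero (Finset.mem_univ i) (Set.indicator_of_notMem hi _)).symm
    _ = _ := by
        rw [h]
        refine Finset.prod_congr rfl fun i _ => ?_
        rw [(measurePreserving_eval (fun _ : ι => Q) i).lintegral_comp (hL.indicator (hs i)),
          lintegral_indicator (hs i), withDensity_apply _ (hs i)]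

/-- If `P` dominates `c • Q` on a set of large `Q`-probability, with `c` close to `1`, then the
expectations of a test under `P` and `Q` are close. -/
theorem abs_integral_sub_le_of_smul_restrict_le {Ω : Type*} [MeasurableSpace Ω]
    {P Q : Measure Ω} [IsProbabilityMeasure P] [IsProbabilityMeasure Q] {G : Set Ω}
    (hG : MeasurableSet G) {c : ℝ} (hc₀ : 0 ≤ c) (hc₁ : c ≤ 1)
    (hPQ : ENNReal.ofReal c • Q.restrict G ≤ P) {φ : Ω → ℝ} (hφ : Measurable φ)
    (hφ' : ∀ x, φ x ∈ Set.Icc (0 : ℝ) 1) :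
    |∫ x, φ x ∂P - ∫ x, φ x ∂Q| ≤ (1 - c) + Q.real Gᶜ := by
  have integ : ∀ (R : Measure Ω) [IsProbabilityMeasure R] (ψ : Ω → ℝ), Measurable ψ →
      (∀ x, ψ x ∈ Set.Icc (0 : ℝ) 1) → Integrable ψ R := fun R _ ψ hψ hψ' =>
    Integrable.of_bound hψ.aestronglyMeasurable 1 (Eventually.of_forall fun x => by
      rw [Real.norm_eq_abs, abs_of_nonneg (hψ' x).1]; exact (hψ' x).2)
  have lower : ∀ ψ : Ω → ℝ, Measurable ψ → (∀ x, ψ x ∈ Set.Icc (0 : ℝ) 1) →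
      ∫ x, ψ x ∂Q - ((1 - c) + Q.real Gᶜ) ≤ ∫ x, ψ x ∂P := by
    intro ψ hψ hψ'
    have h₁ := integral_mono_measure hPQ (Eventually.of_forall fun x => (hψ' x).1)
      (integ P ψ hψ hψ')
    rw [integral_smul_measure, ENNReal.toReal_ofReal hc₀, smul_eq_mul] at h₁
    have h₂ := integral_add_compl hG (integ Q ψ hψ hψ')
    have h₃ : ∫ x in Gᶜ, ψ x ∂Q ≤ Q.real Gᶜ := by
      have := setIntegral_mono (s := Gᶜ) (integ Q ψ hψ hψ').integrableOn
        (integrable_const (1 : ℝ)).integrableOn fun x => (hψ' x).2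
      simpa using this
    have h₄ : ∫ x in G, ψ x ∂Q ≤ 1 := by
      have := setIntegral_mono (s := G) (integ Q ψ hψ hψ').integrableOn
        (integrable_const (1 : ℝ)).integrableOn fun x => (hψ' x).2
      exact this.trans (by simp)
    nlinarith [mul_le_mul_of_nonneg_left h₄ (sub_nonneg.2 hc₁)]
  rw [abs_le]
  constructor
  · linarith [lower φ hφ hφ']
  -- Domination only bounds expectations under `P` from below; the upper bound comes from the
  -- complementary test.
  · have h := lower (fun x => 1 - φ x) (measurable_const.sub hφ)
      (fun x => ⟨sub_nonneg.2 (hφ' x).2, sub_le_self _ (hφ' x).1⟩)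
    rw [integral_sub (integrable_const _) (integ P φ hφ hφ'),
      integral_sub (integrable_const _) (integ Q φ hφ hφ')] at h
    simp only [integral_const, probReal_univ, smul_eq_mul, mul_one] at h
    linarith

theorem Real.abs_log_one_add_sub_le {w : ℝ} (hw : |w| ≤ 1 / 2) :
    |Real.log (1 + w) - w| ≤ 2 * w ^ 2 := by
  have h := Real.abs_log_sub_add_sum_range_le (x := -w) (by rw [abs_neg]; linarith) 1
  simp only [Finset.range_one, Finset.sum_singleton, zero_add, pow_one, Nat.cast_zero, div_one,
    sub_neg_eq_add, abs_neg, one_add_one_eq_two, sq_abs] at h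
  have h' : w ^ 2 / (1 - |w|) ≤ 2 * w ^ 2 := by
    rw [div_le_iff₀ (by linarith)]
    nlinarith [sq_nonneg w]
  calc _ = |-w + Real.log (1 + w)| := by rw [neg_add_eq_sub]
    _ ≤ _ := h.trans h'

/-! ### Hellinger distance and likelihood ratios of samples -/

namespace DominatedModel

variable {k : ℕ} {X : Type*} [MeasurableSpace X]

theorem isProbabilityMeasure_law (m : DominatedModel k X) {θ : EuclideanSpace ℝ (Fin k)}
    (hθ : θ ∈ m.Θ) : IsProbabilityMeasure (m.law θ) :=
  ⟨by rw [law, withDensity_apply _ MeasurableSet.univ, Measure.restrict_univ,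
    m.lintegral_density θ hθ]⟩

theorem integrable_density (m : DominatedModel k X) {θ : EuclideanSpace ℝ (Fin k)}
    (hθ : θ ∈ m.Θ) : Integrable (m.density θ) m.μ := by
  refine ⟨(m.measurable_density θ hθ).aestronglyMeasurable, ?_⟩
  rw [hasFiniteIntegral_iff_ofReal (Eventually.of_forall (m.density_nonneg θ hθ)),
    m.lintegral_density θ hθ]
  exact ENNReal.one_lt_top

theorem integral_density (m : DominatedModel k X) {θ : EuclideanSpace ℝ (Fin k)}
    (hθ : θ ∈ m.Θ) : ∫ x, m.density θ x ∂m.μ = 1 := by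
  rw [integral_eq_lintegral_of_nonneg_ae (Eventually.of_forall (m.density_nonneg θ hθ))
    (m.measurable_density θ hθ).aestronglyMeasurable, m.lintegral_density θ hθ]
  rfl

theorem measurable_sqrt_density (m : DominatedModel k X) {θ : EuclideanSpace ℝ (Fin k)}
    (hθ : θ ∈ m.Θ) : Measurable fun x => Real.sqrt (m.density θ x) :=
  (m.measurable_density θ hθ).sqrt

theorem memLp_sqrt_density (m : DominatedModel k X) {θ : EuclideanSpace ℝ (Fin k)}
    (hθ : θ ∈ m.Θ) : MemLp (fun x => Real.sqrt (m.density θ x)) 2 m.μ := by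
  rw [memLp_two_iff_integrable_sq (m.measurable_sqrt_density hθ).aestronglyMeasurable]
  simpa only [Real.sq_sqrt (m.density_nonneg θ hθ _)] using m.integrable_density hθ

/-- The squared Hellinger distance between two members of the model. -/
noncomputable def hellingerSq (m : DominatedModel k X) (θ₁ θ₂ : EuclideanSpace ℝ (Fin k)) : ℝ :=
  ∫ x, (Real.sqrt (m.density θ₁ x) - Real.sqrt (m.density θ₂ x)) ^ 2 ∂m.μ

theorem hellingerSq_nonneg (m : DominatedModel k X) (θ₁ θ₂ : EuclideanSpace ℝ (Fin k)) :
    0 ≤ m.hellingerSq θ₁ θ₂ :=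
  integral_nonneg fun _ => sq_nonneg _

theorem integral_law (m : DominatedModel k X) {θ : EuclideanSpace ℝ (Fin k)} (hθ : θ ∈ m.Θ)
    (f : X → ℝ) : ∫ x, f x ∂(m.law θ) = ∫ x, m.density θ x * f x ∂m.μ := by
  rw [law, integral_withDensity_eq_integral_toReal_smul
    (m.measurable_density θ hθ).ennreal_ofReal (Eventually.of_forall fun _ => ENNReal.ofReal_lt_top)]
  simp only [ENNReal.toReal_ofReal (m.density_nonneg θ hθ _), smul_eq_mul]

theorem integrable_law_iff (m : DominatedModel k X) {θ : EuclideanSpace ℝ (Fin k)} (hθ : θ ∈ m.Θ)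
    (f : X → ℝ) : Integrable f (m.law θ) ↔ Integrable (fun x => m.density θ x * f x) m.μ := by
  rw [law, integrable_withDensity_iff_integrable_smul'
    (m.measurable_density θ hθ).ennreal_ofReal (Eventually.of_forall fun _ => ENNReal.ofReal_lt_top)]
  simp only [ENNReal.toReal_ofReal (m.density_nonneg θ hθ _), smul_eq_mul]

theorem ae_law_density_pos (m : DominatedModel k X) {θ : EuclideanSpace ℝ (Fin k)}
    (hθ : θ ∈ m.Θ) : ∀ᵐ x ∂(m.law θ), 0 < m.density θ x := by
  rw [law, ae_withDensity_iff (m.measurable_density θ hθ).ennreal_ofReal]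
  exact Eventually.of_forall fun x hx => by simpa using hx

/-- The relative deviation `√(p₁ / p₂) - 1` of the root densities. -/
noncomputable def rootDev (m : DominatedModel k X) (θ₁ θ₂ : EuclideanSpace ℝ (Fin k)) (x : X) :
    ℝ :=
  Real.sqrt (m.density θ₁ x) / Real.sqrt (m.density θ₂ x) - 1

theorem measurable_rootDev (m : DominatedModel k X) {θ₁ θ₂ : EuclideanSpace ℝ (Fin k)}
    (h₁ : θ₁ ∈ m.Θ) (h₂ : θ₂ ∈ m.Θ) : Measurable (m.rootDev θ₁ θ₂) :=
  ((m.measurable_sqrt_density h₁).div (m.measurable_sqrt_density h₂)).sub_const 1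

theorem density_mul_rootDev (m : DominatedModel k X) {θ₁ θ₂ : EuclideanSpace ℝ (Fin k)}
    (h₂ : θ₂ ∈ m.Θ) (x : X) :
    m.density θ₂ x * m.rootDev θ₁ θ₂ x
      = Real.sqrt (m.density θ₁ x) * Real.sqrt (m.density θ₂ x) - m.density θ₂ x := by
  have h := Real.mul_self_sqrt (m.density_nonneg θ₂ h₂ x)
  rw [rootDev]
  rcases eq_or_ne (Real.sqrt (m.density θ₂ x)) 0 with h0 | h0
  · rw [← h, h0]; simp
  · rw [← h]
    simp only [Real.sqrt_mul_self (Real.sqrt_nonneg _)]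
    field_simp

/-- Equality can fail only where `p₂ = 0`: there the left side vanishes while the right side is
`p₁`. -/
theorem density_mul_rootDev_sq_le (m : DominatedModel k X) {θ₁ θ₂ : EuclideanSpace ℝ (Fin k)}
    (h₂ : θ₂ ∈ m.Θ) (x : X) :
    m.density θ₂ x * m.rootDev θ₁ θ₂ x ^ 2
      ≤ (Real.sqrt (m.density θ₁ x) - Real.sqrt (m.density θ₂ x)) ^ 2 := by
  have h := Real.mul_self_sqrt (m.density_nonneg θ₂ h₂ x)
  rw [rootDev]
  rcases eq_or_ne (Real.sqrt (m.density θ₂ x)) 0 with h0 | h0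
  · rw [← h, h0]; simp only [mul_zero, zero_mul]; positivity
  · refine le_of_eq ?_
    rw [← h]
    simp only [Real.sqrt_mul_self (Real.sqrt_nonneg _)]
    field_simp

theorem integrable_sqrt_sub_sq (m : DominatedModel k X) {θ₁ θ₂ : EuclideanSpace ℝ (Fin k)}
    (h₁ : θ₁ ∈ m.Θ) (h₂ : θ₂ ∈ m.Θ) :
    Integrable (fun x => (Real.sqrt (m.density θ₁ x) - Real.sqrt (m.density θ₂ x)) ^ 2) m.μ :=
  ((m.memLp_sqrt_density h₁).sub (m.memLp_sqrt_density h₂)).integrable_sq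

theorem integrable_rootDev_sq (m : DominatedModel k X) {θ₁ θ₂ : EuclideanSpace ℝ (Fin k)}
    (h₁ : θ₁ ∈ m.Θ) (h₂ : θ₂ ∈ m.Θ) :
    Integrable (fun x => m.rootDev θ₁ θ₂ x ^ 2) (m.law θ₂) := by
  rw [m.integrable_law_iff h₂]
  refine (m.integrable_sqrt_sub_sq h₁ h₂).mono'
    ((m.measurable_density θ₂ h₂).mul ((m.measurable_rootDev h₁ h₂).pow_const 2)).aestronglyMeasurable
    (Eventually.of_forall fun x => ?_)
  rw [Real.norm_eq_abs, abs_of_nonneg (mul_nonneg (m.density_nonneg θ₂ h₂ x) (sq_nonneg _))]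
  exact m.density_mul_rootDev_sq_le h₂ x

theorem memLp_rootDev (m : DominatedModel k X) {θ₁ θ₂ : EuclideanSpace ℝ (Fin k)}
    (h₁ : θ₁ ∈ m.Θ) (h₂ : θ₂ ∈ m.Θ) : MemLp (m.rootDev θ₁ θ₂) 2 (m.law θ₂) :=
  (memLp_two_iff_integrable_sq (m.measurable_rootDev h₁ h₂).aestronglyMeasurable).2
    (m.integrable_rootDev_sq h₁ h₂)

theorem integral_rootDev_sq_le (m : DominatedModel k X) {θ₁ θ₂ : EuclideanSpace ℝ (Fin k)}
    (h₁ : θ₁ ∈ m.Θ) (h₂ : θ₂ ∈ m.Θ) :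
    ∫ x, m.rootDev θ₁ θ₂ x ^ 2 ∂(m.law θ₂) ≤ m.hellingerSq θ₁ θ₂ := by
  rw [m.integral_law h₂]
  exact integral_mono ((m.integrable_law_iff h₂ _).1 (m.integrable_rootDev_sq h₁ h₂))
    (m.integrable_sqrt_sub_sq h₁ h₂) (m.density_mul_rootDev_sq_le h₂)

/-- Expand the square and use that both densities integrate to 1. The mean of `W` is thus of the
order of its second moment, which keeps the drift of `∑ Wᵢ` at `O(n H)`. -/
theorem integral_rootDev (m : DominatedModel k X) {θ₁ θ₂ : EuclideanSpace ℝ (Fin k)}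
    (h₁ : θ₁ ∈ m.Θ) (h₂ : θ₂ ∈ m.Θ) :
    ∫ x, m.rootDev θ₁ θ₂ x ∂(m.law θ₂) = -(m.hellingerSq θ₁ θ₂ / 2) := by
  have hi : ∀ x, m.density θ₂ x * m.rootDev θ₁ θ₂ x
      = (1 / 2) * (m.density θ₁ x - m.density θ₂ x)
        - (1 / 2) * (Real.sqrt (m.density θ₁ x) - Real.sqrt (m.density θ₂ x)) ^ 2 := by
    intro x
    rw [m.density_mul_rootDev h₂, sub_sq, Real.sq_sqrt (m.density_nonneg _ h₁ x),
      Real.sq_sqrt (m.density_nonneg _ h₂ x)]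
    ring
  have hd : Integrable (fun x => m.density θ₁ x - m.density θ₂ x) m.μ :=
    (m.integrable_density h₁).sub (m.integrable_density h₂)
  rw [m.integral_law h₂]
  simp_rw [hi]
  rw [integral_sub (hd.const_mul _) ((m.integrable_sqrt_sub_sq h₁ h₂).const_mul _), integral_const_mul, integral_const_mul,
    integral_sub (m.integrable_density h₁) (m.integrable_density h₂), m.integral_density h₁,
    m.integral_density h₂, hellingerSq]
  ring

/-- The samples of positive likelihood whose log-likelihoods at `θ₁` and `θ₂` differ by less than
`δ`. -/
def logLikClose (m : DominatedModel k X) (n : ℕ) (δ : ℝ) (θ₁ θ₂ : EuclideanSpace ℝ (Fin k)) :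
    Set (Fin n → X) :=
  {x | (∀ i, 0 < m.density θ₁ (x i) ∧ 0 < m.density θ₂ (x i)) ∧
    |m.logLik θ₁ x - m.logLik θ₂ x| < δ}

theorem measurable_logLik (m : DominatedModel k X) (n : ℕ) {θ : EuclideanSpace ℝ (Fin k)}
    (hθ : θ ∈ m.Θ) : Measurable fun x : Fin n → X => m.logLik θ x :=
  Finset.measurable_sum _ fun i _ =>
    ((m.measurable_density θ hθ).comp (measurable_pi_apply i)).log

theorem measurableSet_logLikClose (m : DominatedModel k X) (n : ℕ) (δ : ℝ)
    {θ₁ θ₂ : EuclideanSpace ℝ (Fin k)} (h₁ : θ₁ ∈ m.Θ) (h₂ : θ₂ ∈ m.Θ) :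
    MeasurableSet (m.logLikClose n δ θ₁ θ₂) := by
  have hp : ∀ θ ∈ m.Θ, ∀ i : Fin n, MeasurableSet {x : Fin n → X | 0 < m.density θ (x i)} :=
    fun θ hθ i => measurableSet_lt measurable_const
      ((m.measurable_density θ hθ).comp (measurable_pi_apply i))
  have hall : MeasurableSet
      {x : Fin n → X | ∀ i, 0 < m.density θ₁ (x i) ∧ 0 < m.density θ₂ (x i)} := by
    rw [Set.ofPred_forall]
    exact MeasurableSet.iInter fun i => (hp θ₁ h₁ i).inter (hp θ₂ h₂ i)
  exact hall.inter (measurableSet_lt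
    (((m.measurable_logLik n h₁).sub (m.measurable_logLik n h₂)).abs) measurable_const)

theorem isProbabilityMeasure_sampleLaw (m : DominatedModel k X) (n : ℕ)
    {θ : EuclideanSpace ℝ (Fin k)} (hθ : θ ∈ m.Θ) : IsProbabilityMeasure (m.sampleLaw n θ) := by
  have := m.isProbabilityMeasure_law hθ
  rw [sampleLaw]
  infer_instance

/-- The log-likelihood difference is `2 ∑ log (1 + Wᵢ)`, within `4 ∑ Wᵢ²` of `2 ∑ Wᵢ`. The threshold
`1/4` forces `|Wᵢ| ≤ 1/2`, where the logarithm bound applies; the other two thresholds contribute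
`δ/2` each. -/
theorem mem_logLikClose_of_rootDev (m : DominatedModel k X) {n : ℕ} {δ : ℝ}
    {θ₁ θ₂ : EuclideanSpace ℝ (Fin k)} (h₁ : θ₁ ∈ m.Θ) {x : Fin n → X}
    (hpos : ∀ i, 0 < m.density θ₂ (x i))
    (hS : |∑ i, m.rootDev θ₁ θ₂ (x i)| < δ / 4)
    (hV : ∑ i, m.rootDev θ₁ θ₂ (x i) ^ 2 < min (1 / 4) (δ / 8)) :
    x ∈ m.logLikClose n δ θ₁ θ₂ := by
  obtain ⟨hV₁, hV₂⟩ := lt_min_iff.1 hV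
  have hw : ∀ i, |m.rootDev θ₁ θ₂ (x i)| ≤ 1 / 2 := fun i => by
    have := Finset.single_le_sum (f := fun i => m.rootDev θ₁ θ₂ (x i) ^ 2)
      (fun j _ => sq_nonneg _) (Finset.mem_univ i)
    exact abs_le_of_sq_le_sq (by norm_num; linarith) (by norm_num)
  -- A zero of `p₁` would give `W = -1`, contrary to `|W| ≤ 1/2`.
  have hpos₁ : ∀ i, 0 < m.density θ₁ (x i) := fun i => by
    refine (m.density_nonneg θ₁ h₁ _).lt_of_ne fun h => ?_
    have := hw i
    rw [rootDev, ← h] at this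
    norm_num at this
  have hlog : ∀ i, Real.log (m.density θ₁ (x i)) - Real.log (m.density θ₂ (x i))
      = 2 * Real.log (1 + m.rootDev θ₁ θ₂ (x i)) := fun i => by
    rw [rootDev, add_sub_cancel, Real.log_div (Real.sqrt_pos.2 (hpos₁ i)).ne'
      (Real.sqrt_pos.2 (hpos i)).ne', Real.log_sqrt (hpos₁ i).le, Real.log_sqrt (hpos i).le]
    ring
  refine ⟨fun i => ⟨hpos₁ i, hpos i⟩, ?_⟩
  rw [logLik, logLik, ← Finset.sum_sub_distrib, Finset.sum_congr rfl fun i _ => hlog i,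
    ← Finset.mul_sum, abs_mul, abs_two]
  have hsum : |∑ i, Real.log (1 + m.rootDev θ₁ θ₂ (x i)) - ∑ i, m.rootDev θ₁ θ₂ (x i)|
      ≤ 2 * ∑ i, m.rootDev θ₁ θ₂ (x i) ^ 2 := by
    rw [← Finset.sum_sub_distrib, Finset.mul_sum]
    exact (Finset.abs_sum_le_sum_abs _ _).trans
      (Finset.sum_le_sum fun i _ => Real.abs_log_one_add_sub_le (hw i))
  have := abs_sub_abs_le_abs_sub (∑ i, Real.log (1 + m.rootDev θ₁ θ₂ (x i)))
    (∑ i, m.rootDev θ₁ θ₂ (x i))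
  linarith

/-- Chebyshev controls `∑ Wᵢ` and Markov controls `∑ Wᵢ²`. The assumption `hn` keeps the mean `-n H
/ 2` of `∑ Wᵢ` within `δ/8`, so a fluctuation below `δ/8` leaves the sum below `δ/4`. -/
theorem sampleLaw_real_compl_logLikClose_le (m : DominatedModel k X) (n : ℕ) {δ : ℝ} (hδ : 0 < δ)
    {θ₁ θ₂ : EuclideanSpace ℝ (Fin k)} (h₁ : θ₁ ∈ m.Θ) (h₂ : θ₂ ∈ m.Θ)
    (hn : n * m.hellingerSq θ₁ θ₂ ≤ δ / 4) :
    (m.sampleLaw n θ₂).real (m.logLikClose n δ θ₁ θ₂)ᶜ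
      ≤ n * m.hellingerSq θ₁ θ₂ / (δ / 8) ^ 2
        + n * m.hellingerSq θ₁ θ₂ / min (1 / 4) (δ / 8) := by
  have hQ := m.isProbabilityMeasure_law h₂
  have hQn := m.isProbabilityMeasure_sampleLaw n h₂
  set Q := m.sampleLaw n θ₂ with hQdef
  set H := m.hellingerSq θ₁ θ₂ with hH
  have hη : 0 < min (1 / 4) (δ / 8) := lt_min (by norm_num) (by linarith)
  set η := min (1 / 4) (δ / 8)
  have hmp : ∀ i : Fin n, MeasurePreserving (Function.eval i) Q (m.law θ₂) :=
    fun i => measurePreserving_eval _ i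
  have hint : ∀ f : X → ℝ, Integrable f (m.law θ₂) →
      Integrable (fun x : Fin n → X => ∑ i, f (x i)) Q ∧
        ∫ x : Fin n → X, ∑ i, f (x i) ∂Q = n * ∫ x, f x ∂(m.law θ₂) := by
    intro f hf
    have hfi : ∀ i ∈ Finset.univ, Integrable (fun x : Fin n → X => f (x i)) Q :=
      fun i _ => (hmp i).integrable_comp_of_integrable hf
    refine ⟨integrable_finsetSum _ hfi, ?_⟩
    rw [integral_finsetSum _ hfi]
    have : ∀ i : Fin n, ∫ x : Fin n → X, f (x i) ∂Q = ∫ x, f x ∂(m.law θ₂) := fun i => by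
      rw [← (hmp i).map_eq, integral_map (hmp i).measurable.aemeasurable
        (by rw [(hmp i).map_eq]; exact hf.aestronglyMeasurable)]
    simp [this]
  have hW := m.memLp_rootDev h₁ h₂
  set S : (Fin n → X) → ℝ := fun x => ∑ i, m.rootDev θ₁ θ₂ (x i) with hS
  set V : (Fin n → X) → ℝ := fun x => ∑ i, m.rootDev θ₁ θ₂ (x i) ^ 2 with hV
  have hSeq : S = ∑ i : Fin n, fun x : Fin n → X => m.rootDev θ₁ θ₂ (x i) := by
    ext x; simp [hS]
  have hSLp : MemLp S 2 Q := by
    rw [hSeq]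
    exact memLp_finsetSum' _ fun i _ => hW.comp_measurePreserving (hmp i)
  have hSmean : ∫ x, S x ∂Q = -(n * H / 2) := by
    rw [(hint _ (hW.integrable one_le_two)).2, m.integral_rootDev h₁ h₂]
    ring
  have hSvar : Var[S; Q] ≤ n * H := by
    rw [hSeq, hQdef, sampleLaw, variance_sum_pi (fun _ => hW), Finset.sum_const,
      Finset.card_univ, Fintype.card_fin, nsmul_eq_mul]
    gcongr
    exact (variance_le_expectation_sq hW.aestronglyMeasurable).trans
      (m.integral_rootDev_sq_le h₁ h₂)
  have hcheb : Q.real {x | δ / 8 ≤ |S x - ∫ y, S y ∂Q|} ≤ n * H / (δ / 8) ^ 2 := by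
    refine (ENNReal.toReal_le_of_le_ofReal (div_nonneg (variance_nonneg _ _) (sq_nonneg _))
      (meas_ge_le_variance_div_sq hSLp (by linarith : 0 < δ / 8))).trans ?_
    gcongr
  have hmark : Q.real {x | η ≤ V x} ≤ n * H / η := by
    obtain ⟨hVi, hVm⟩ := hint _ (m.integrable_rootDev_sq h₁ h₂)
    have := mul_meas_ge_le_integral_of_nonneg
      (Eventually.of_forall fun x => Finset.sum_nonneg fun i _ => sq_nonneg _) hVi η
    rw [le_div_iff₀ hη, mul_comm]
    refine this.trans (hVm.trans_le ?_)
    gcongr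
    exact m.integral_rootDev_sq_le h₁ h₂
  have hpos : Q {x | ¬ ∀ i, 0 < m.density θ₂ (x i)} = 0 := by
    refine ae_iff.1 (ae_all_iff.2 fun i => ?_)
    exact (hmp i).quasiMeasurePreserving.ae (m.ae_law_density_pos h₂)
  have hsub : (m.logLikClose n δ θ₁ θ₂)ᶜ ⊆ ({x | δ / 8 ≤ |S x - ∫ y, S y ∂Q|} ∪ {x | η ≤ V x}) ∪
      {x | ¬ ∀ i, 0 < m.density θ₂ (x i)} := by
    intro x hx
    by_contra hcon
    simp only [Set.mem_union, Set.mem_ofPred_eq, not_or, not_le, not_not] at hcon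
    obtain ⟨⟨hxS, hxV⟩, hxp⟩ := hcon
    refine hx (m.mem_logLikClose_of_rootDev h₁ hxp ?_ hxV)
    rw [hSmean] at hxS
    have hH0 : 0 ≤ n * H := mul_nonneg (Nat.cast_nonneg n) (m.hellingerSq_nonneg _ _)
    have hSx : |S x| < δ / 4 := by
      rw [abs_lt] at hxS ⊢
      constructor <;> linarith [hxS.1, hxS.2]
    exact hSx
  refine (measureReal_mono hsub).trans ((measureReal_union_le _ _).trans ?_)
  rw [measureReal_def Q {x | ¬ ∀ i, 0 < m.density θ₂ (x i)}, hpos, ENNReal.toReal_zero, add_zero]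
  exact (measureReal_union_le _ _).trans (add_le_add hcheb hmark)

/-- On `{p₂ > 0}` the law `P_{θ₁}` has density `p₁/p₂` with respect to `P_{θ₂}`, and on the close
set the product density is `exp (ℓ(θ₁) - ℓ(θ₂)) ≥ e^{-δ}`. Mass of `P_{θ₁}` on `{p₂ = 0}` is simply
dropped, so absolute continuity is not needed. -/
theorem smul_restrict_logLikClose_le (m : DominatedModel k X) (n : ℕ) (δ : ℝ)
    {θ₁ θ₂ : EuclideanSpace ℝ (Fin k)} (h₁ : θ₁ ∈ m.Θ) (h₂ : θ₂ ∈ m.Θ) :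
    ENNReal.ofReal (Real.exp (-δ)) • (m.sampleLaw n θ₂).restrict (m.logLikClose n δ θ₁ θ₂)
      ≤ m.sampleLaw n θ₁ := by
  have hP := m.isProbabilityMeasure_law h₁
  have hQ := m.isProbabilityMeasure_law h₂
  have hA : MeasurableSet {x | 0 < m.density θ₂ x} :=
    measurableSet_lt measurable_const (m.measurable_density θ₂ h₂)
  set L : X → ENNReal := fun x => ENNReal.ofReal (m.density θ₁ x / m.density θ₂ x) with hL
  have hLm : Measurable L :=
    ((m.measurable_density θ₁ h₁).div (m.measurable_density θ₂ h₂)).ennreal_ofReal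
  have hPL : (m.law θ₁).restrict {x | 0 < m.density θ₂ x} = (m.law θ₂).withDensity L := by
    rw [law, law, ← withDensity_mul _ (m.measurable_density θ₂ h₂).ennreal_ofReal hLm,
      restrict_withDensity hA, ← withDensity_indicator hA]
    congr 1
    ext x
    by_cases hx : 0 < m.density θ₂ x
    · rw [Set.indicator_of_mem (by exact hx), Pi.mul_apply, hL,
        ← ENNReal.ofReal_mul hx.le, mul_div_cancel₀ _ hx.ne']
    · rw [Set.indicator_of_notMem (by exact hx), Pi.mul_apply, ENNReal.ofReal_of_nonpos
        (not_lt.1 hx), zero_mul]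
  have hfin : IsFiniteMeasure ((m.law θ₂).withDensity L) := by rw [← hPL]; infer_instance
  have hpi : (m.sampleLaw n θ₁).restrict (Set.univ.pi fun _ => {x | 0 < m.density θ₂ x})
      = (m.sampleLaw n θ₂).withDensity fun x => ∏ i, L (x i) := by
    rw [sampleLaw, Measure.restrict_pi_pi, hPL, pi_withDensity_eq _ hLm, sampleLaw]
  refine le_trans ?_
    (Measure.restrict_le_self (s := Set.univ.pi fun _ => {x | 0 < m.density θ₂ x}))
  rw [hpi, ← withDensity_const,
    ← withDensity_indicator (m.measurableSet_logLikClose n δ h₁ h₂)]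
  refine withDensity_mono (Eventually.of_forall fun x => ?_)
  by_cases hx : x ∈ m.logLikClose n δ θ₁ θ₂
  swap
  · rw [Set.indicator_of_notMem hx]
    exact zero_le
  rw [Set.indicator_of_mem hx]
  obtain ⟨hp, hl⟩ := hx
  change _ ≤ ∏ i, ENNReal.ofReal (m.density θ₁ (x i) / m.density θ₂ (x i))
  rw [← ENNReal.ofReal_prod_of_nonneg fun i _ => (div_pos (hp i).1 (hp i).2).le]
  refine ENNReal.ofReal_le_ofReal ?_
  have hexp : ∏ i, m.density θ₁ (x i) / m.density θ₂ (x i)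
      = Real.exp (m.logLik θ₁ x - m.logLik θ₂ x) := by
    rw [logLik, logLik, ← Finset.sum_sub_distrib, Real.exp_sum]
    refine Finset.prod_congr rfl fun i _ => ?_
    rw [Real.exp_sub, Real.exp_log (hp i).1, Real.exp_log (hp i).2]
  rw [hexp]
  exact Real.exp_le_exp.2 (abs_lt.1 hl).1.le

/-- If the Hellinger distance of one observation is `o(n^{-1/2})`, then the sequences of parameters
cannot be told apart from `n` observations. -/
theorem asympIndistinguishable_of_hellingerSq (m : DominatedModel k X)
    {θ₁ θ₂ : ℕ → EuclideanSpace ℝ (Fin k)} (h₁ : ∀ n, θ₁ n ∈ m.Θ) (h₂ : ∀ n, θ₂ n ∈ m.Θ)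
    (hH : Tendsto (fun n : ℕ => n * m.hellingerSq (θ₁ n) (θ₂ n)) atTop (𝓝 0)) :
    m.AsympIndistinguishable θ₁ θ₂ := by
  have hP := fun n => m.isProbabilityMeasure_sampleLaw n (h₁ n)
  have hQ := fun n => m.isProbabilityMeasure_sampleLaw n (h₂ n)
  have hcompl : ∀ δ : ℝ, 0 < δ → Tendsto
      (fun n => (m.sampleLaw n (θ₂ n)).real (m.logLikClose n δ (θ₁ n) (θ₂ n))ᶜ) atTop (𝓝 0) := by
    intro δ hδ
    have hb : Tendsto (fun n : ℕ => n * m.hellingerSq (θ₁ n) (θ₂ n) / (δ / 8) ^ 2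
        + n * m.hellingerSq (θ₁ n) (θ₂ n) / min (1 / 4) (δ / 8)) atTop (𝓝 0) := by
      simpa using (hH.div_const ((δ / 8) ^ 2)).add (hH.div_const (min (1 / 4) (δ / 8)))
    refine squeeze_zero' (Eventually.of_forall fun n => measureReal_nonneg) ?_ hb
    filter_upwards [hH.eventually (eventually_le_nhds (by linarith : (0 : ℝ) < δ / 4))] with n hn
    exact m.sampleLaw_real_compl_logLikClose_le n hδ (h₁ n) (h₂ n) hn
  refine ⟨fun φ hφ hφ' => ?_, fun δ hδ => ?_⟩
  · rw [Metric.tendsto_atTop]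
    intro ε hε
    obtain ⟨δ, hδ, hδε⟩ : ∃ δ : ℝ, 0 < δ ∧ 1 - Real.exp (-δ) < ε / 2 := by
      refine ⟨ε / 4, by linarith, ?_⟩
      linarith [Real.add_one_le_exp (-(ε / 4))]
    obtain ⟨N, hN⟩ := eventually_atTop.1 ((hcompl δ hδ).eventually
      (eventually_lt_nhds (by linarith : (0 : ℝ) < ε / 2)))
    refine ⟨N, fun n hn => ?_⟩
    rw [Real.dist_0_eq_abs]
    refine (abs_integral_sub_le_of_smul_restrict_le
      (m.measurableSet_logLikClose n δ (h₁ n) (h₂ n)) (Real.exp_pos _).le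
      (Real.exp_le_one_iff.2 (by linarith)) (m.smul_restrict_logLikClose_le n δ (h₁ n) (h₂ n))
      (hφ n) (hφ' n)).trans_lt ?_
    linarith [hN n hn]
  · have h := (hcompl δ hδ).const_sub 1
    have h' : Tendsto (fun n => (m.sampleLaw n (θ₂ n)).real
        (m.logLikClose n δ (θ₁ n) (θ₂ n))) atTop (𝓝 1) := by
      rw [sub_zero] at h
      refine h.congr fun n => ?_
      rw [probReal_compl_eq_one_sub (m.measurableSet_logLikClose n δ (h₁ n) (h₂ n))]
      ring
    have h'' := ENNReal.tendsto_ofReal h'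
    rw [ENNReal.ofReal_one] at h''
    exact h''.congr fun n => ofReal_measureReal

end DominatedModel

/-! ### Local Lipschitz continuity of root densities under DDQM -/

/-- A map admitting, near the origin, uniform first-order expansions around every point is
Lipschitz near the origin. The differentials are not assumed to be uniformly bounded. -/
theorem exists_lipschitz_of_uniform_expansion {E V : Type*} [NormedAddCommGroup E]
    [NormedSpace ℝ E] [FiniteDimensional ℝ E] [NormedAddCommGroup V] [NormedSpace ℝ V]
    {F : E → V} {D : E → E →ₗ[ℝ] V} {δ : ℝ}
    (h : ∀ x y, ‖x‖ < δ → ‖y‖ < δ → ‖F x - F y - D y (x - y)‖ ≤ ‖x - y‖) :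
    ∃ C : ℝ, 0 ≤ C ∧ ∀ x y, ‖x‖ < δ / 2 → ‖y‖ < δ / 2 → ‖F x - F y‖ ≤ C * ‖x - y‖ := by
  set C := ‖LinearMap.toContinuousLinearMap (D 0)‖
  have hD₀ : ∀ v, ‖D 0 v‖ ≤ C * ‖v‖ := fun v =>
    (LinearMap.toContinuousLinearMap (D 0)).le_opNorm v
  have hC : 0 ≤ C := norm_nonneg _
  refine ⟨C + 5, by linarith, fun x y hx hy => ?_⟩
  have hδ : 0 < δ := by linarith [norm_nonneg x]
  have hD : ‖D y (x - y)‖ ≤ (C + 4) * ‖x - y‖ := by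
    rcases eq_or_ne y 0 with rfl | hy0
    · refine (hD₀ _).trans ?_
      gcongr
      linarith
    rcases eq_or_ne (x - y) 0 with hv | hv
    · simp [hv]
    set v := x - y
    have hvn : 0 < ‖v‖ := norm_pos_iff.2 hv
    have hyn : 0 < ‖y‖ := norm_pos_iff.2 hy0
    -- Rescaling the increment to length `‖y‖` keeps `y + r • v` within `2 ‖y‖ < δ`, so the
    -- expansions at `y` and at `0` can be compared there. Their errors are `2 ‖y‖`, `‖y‖` and
    -- `‖y‖`, hence the constant `C + 4`.
    set r := ‖y‖ / ‖v‖ with hr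
    have hr0 : 0 < r := div_pos hyn hvn
    have hw : ‖r • v‖ = ‖y‖ := by
      rw [norm_smul, Real.norm_of_nonneg hr0.le, hr, div_mul_cancel₀ _ hvn.ne']
    have hyw : ‖y + r • v‖ ≤ 2 * ‖y‖ := (norm_add_le _ _).trans (by rw [hw]; linarith)
    have a := h (y + r • v) y (by linarith) (by linarith)
    have b := h (y + r • v) 0 (by linarith) (by simpa using hδ)
    have c := h y 0 (by linarith) (by simpa using hδ)
    rw [add_sub_cancel_left, hw] at a
    rw [sub_zero] at b c
    have hkey : ‖D y (r • v)‖ ≤ (C + 4) * ‖y‖ := by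
      have heq : D y (r • v) = D 0 (r • v) + ((F (y + r • v) - F 0 - D 0 (y + r • v))
          - (F y - F 0 - D 0 y)) - (F (y + r • v) - F y - D y (r • v)) := by
        rw [map_add]; abel
      rw [heq]
      refine (norm_sub_le _ _).trans ?_
      have h₁ := norm_add_le (D 0 (r • v)) ((F (y + r • v) - F 0 - D 0 (y + r • v))
          - (F y - F 0 - D 0 y))
      have h₂ := norm_sub_le (F (y + r • v) - F 0 - D 0 (y + r • v)) (F y - F 0 - D 0 y)
      have h₃ := hD₀ (r • v)
      rw [hw] at h₃
      linarith
    rw [map_smul, norm_smul, Real.norm_of_nonneg hr0.le] at hkey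
    have : r * ‖v‖ = ‖y‖ := by rw [hr, div_mul_cancel₀ _ hvn.ne']
    rw [← this] at hkey
    exact le_of_mul_le_mul_left (by linarith) hr0
  have := h x y (by linarith) (by linarith)
  calc ‖F x - F y‖ = ‖(F x - F y - D y (x - y)) + D y (x - y)‖ := by rw [sub_add_cancel]
    _ ≤ _ := (norm_add_le _ _).trans (by linarith)

theorem MeasureTheory.L2.norm_sq_eq_integral_sq {Ω : Type*} [MeasurableSpace Ω] {μ : Measure Ω}
    (f : Lp ℝ 2 μ) {g : Ω → ℝ} (h : f =ᵐ[μ] g) : ‖f‖ ^ 2 = ∫ x, g x ^ 2 ∂μ := by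
  rw [← real_inner_self_eq_norm_sq, L2.inner_def]
  refine integral_congr_ae ?_
  filter_upwards [h] with x hx
  rw [real_inner_self_eq_norm_sq, hx, Real.norm_eq_abs, sq_abs]

namespace DominatedModel

variable {k : ℕ} {X : Type*} [MeasurableSpace X]

/-- The sequential definition of double differentiability in quadratic mean, in uniform form. -/
theorem exists_uniform_of_ddqm (m : DominatedModel k X) {θ : EuclideanSpace ℝ (Fin k)}
    {s : EuclideanSpace ℝ (Fin k) → X → EuclideanSpace ℝ (Fin k)}
    (hs : ∀ h h' : ℕ → EuclideanSpace ℝ (Fin k),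
      Tendsto h atTop (𝓝 0) → Tendsto h' atTop (𝓝 0) →
        (∀ᶠ n in atTop, Integrable (m.ddqmRemainder s θ (h n) (h' n)) m.μ) ∧
        (fun n => ∫ x, m.ddqmRemainder s θ (h n) (h' n) x ∂m.μ)
          =o[atTop] fun n => ‖h n - h' n‖ ^ 2) :
    ∃ δ : ℝ, 0 < δ ∧ ∀ h h' : EuclideanSpace ℝ (Fin k), ‖h‖ < δ → ‖h'‖ < δ →
      Integrable (m.ddqmRemainder s θ h h') m.μ ∧
        ∫ x, m.ddqmRemainder s θ h h' x ∂m.μ ≤ ‖h - h'‖ ^ 2 := by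
  by_contra! hcon
  choose h h' hh hh' hbad using fun n : ℕ =>
    hcon (1 / ((n : ℝ) + 1)) Nat.one_div_pos_of_nat
  have lim : ∀ u : ℕ → EuclideanSpace ℝ (Fin k), (∀ n : ℕ, ‖u n‖ < 1 / ((n : ℝ) + 1)) →
      Tendsto u atTop (𝓝 0) := fun u hu =>
    squeeze_zero_norm (fun n => (hu n).le) tendsto_one_div_add_atTop_nhds_zero_nat
  obtain ⟨h₁, h₂⟩ := hs h h' (lim h hh) (lim h' hh')
  -- The little-o is used only with constant 1, which suffices for a Lipschitz bound.
  obtain ⟨n, hn₁, hn₂⟩ := (h₁.and (h₂.bound one_pos)).exists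
  refine (hbad n hn₁).not_ge ?_
  rw [one_mul, Real.norm_eq_abs, Real.norm_of_nonneg (sq_nonneg _)] at hn₂
  exact (le_abs_self _).trans hn₂

/-- Under double differentiability in quadratic mean, the squared Hellinger distance is locally
bounded by a multiple of the squared distance of the parameters. -/
theorem DDQMAt.exists_hellingerSq_le {m : DominatedModel k X} {θ : EuclideanSpace ℝ (Fin k)}
    (hθ : m.DDQMAt θ) :
    ∃ C δ : ℝ, 0 < δ ∧ ∀ h h' : EuclideanSpace ℝ (Fin k), ‖h‖ < δ → ‖h'‖ < δ →
      m.hellingerSq (θ + h) (θ + h') ≤ C * ‖h - h'‖ ^ 2 := by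
  obtain ⟨hθΘ, s, hsm, hs⟩ := hθ
  obtain ⟨δ₁, hδ₁, hball⟩ := Metric.isOpen_iff.1 m.isOpen_Θ θ hθΘ
  obtain ⟨δ₂, hδ₂, hunif⟩ := m.exists_uniform_of_ddqm hs
  set δ := min δ₁ δ₂
  have hδ : 0 < δ := lt_min hδ₁ hδ₂
  have hmem : ∀ h : EuclideanSpace ℝ (Fin k), ‖h‖ < δ → θ + h ∈ m.Θ := fun h hh =>
    hball (by simpa using hh.trans_le (min_le_left _ _))
  replace hunif := fun h h' (hh : ‖h‖ < δ) (hh' : ‖h'‖ < δ) =>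
    hunif h h' (hh.trans_le (min_le_right _ _)) (hh'.trans_le (min_le_right _ _))
  set g : EuclideanSpace ℝ (Fin k) → EuclideanSpace ℝ (Fin k) → X → ℝ := fun h' v x =>
    1 / 2 * inner ℝ v (s (θ + h') x) * Real.sqrt (m.density (θ + h') x) with hg
  have hgm : ∀ h', ‖h'‖ < δ → ∀ v, Measurable (g h' v) := fun h' hh' v =>
    ((measurable_const.inner (hsm _ (hmem h' hh'))).const_mul _).mul
      (m.measurable_sqrt_density (hmem h' hh'))
  have hgsmul : ∀ h' (c : ℝ) v, g h' (c • v) = c • g h' v := fun h' c v => by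
    ext x
    simp only [hg, real_inner_smul_left, Pi.smul_apply, smul_eq_mul]
    ring
  have hgadd : ∀ h' v w, g h' (v + w) = g h' v + g h' w := fun h' v w => by
    ext x
    simp only [hg, inner_add_left, Pi.add_apply]
    ring
  have hremm : ∀ h h', ‖h‖ < δ → ‖h'‖ < δ → MemLp (fun x => Real.sqrt (m.density (θ + h) x)
      - Real.sqrt (m.density (θ + h') x) - g h' (h - h') x) 2 m.μ := fun h h' hh hh' =>
    (memLp_two_iff_integrable_sq (((m.measurable_sqrt_density (hmem h hh)).sub
      (m.measurable_sqrt_density (hmem h' hh'))).sub (hgm h' hh' _)).aestronglyMeasurable).2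
      (hunif h h' hh hh').1
  have hgLp : ∀ h', ‖h'‖ < δ → ∀ v, MemLp (g h' v) 2 m.μ := by
    intro h' hh' v
    -- Square integrability of the score term is extracted from the remainder: for `t` small, `g h'
    -- (t • v)` is a difference of root densities minus the remainder, all in `L²`; then divide by
    -- `t`.
    obtain ⟨t, ht, htv⟩ : ∃ t : ℝ, 0 < t ∧ ‖h' + t • v‖ < δ := by
      have hc : ContinuousAt (fun t : ℝ => ‖h' + t • v‖) 0 := by fun_prop
      have he := hc.eventually (eventually_lt_nhds (by simpa using hh'))
      have he' : ∀ᶠ t in 𝓝[>] (0 : ℝ), ‖h' + t • v‖ < δ := he.filter_mono nhdsWithin_le_nhds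
      obtain ⟨t, ht₁, ht₂⟩ := (he'.and self_mem_nhdsWithin).exists
      exact ⟨t, ht₂, ht₁⟩
    have h₁ := (((m.memLp_sqrt_density (hmem _ htv)).sub
      (m.memLp_sqrt_density (hmem _ hh'))).sub (hremm _ _ htv hh')).const_smul t⁻¹
    convert h₁ using 1
    ext x
    simp only [Pi.smul_apply, Pi.sub_apply, sub_sub_cancel, add_sub_cancel_left, hgsmul,
      smul_eq_mul]
    rw [inv_mul_cancel_left₀ ht.ne']
  -- The `L²`-valued map and its differentials are set to the junk value 0 outside the ball.
  have hF : ∀ h, ∃ f : Lp ℝ 2 m.μ, ‖h‖ < δ → f =ᵐ[m.μ] fun x => Real.sqrt (m.density (θ + h) x) := by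
    intro h
    by_cases hh : ‖h‖ < δ
    · exact ⟨_, fun _ => (m.memLp_sqrt_density (hmem h hh)).coeFn_toLp⟩
    · exact ⟨0, fun h => absurd h hh⟩
  have hD : ∀ h', ∃ f : EuclideanSpace ℝ (Fin k) →ₗ[ℝ] Lp ℝ 2 m.μ,
      ‖h'‖ < δ → ∀ v, f v =ᵐ[m.μ] g h' v := by
    intro h'
    by_cases hh : ‖h'‖ < δ
    · refine ⟨{ toFun := fun v => (hgLp h' hh v).toLp
                map_add' := fun v w => ?_
                map_smul' := fun c v => ?_ }, fun _ v => (hgLp h' hh v).coeFn_toLp⟩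
      · rw [← MemLp.toLp_add]
        simp only [hgadd]
      · rw [RingHom.id_apply, ← MemLp.toLp_const_smul]
        simp only [hgsmul]
    · exact ⟨0, fun h => absurd h hh⟩
  choose F hF using hF
  choose D hD using hD
  have hexp : ∀ h h', ‖h‖ < δ → ‖h'‖ < δ → ‖F h - F h' - D h' (h - h')‖ ≤ ‖h - h'‖ := by
    intro h h' hh hh'
    refine le_of_sq_le_sq ?_ (norm_nonneg _)
    rw [L2.norm_sq_eq_integral_sq (g := fun x => Real.sqrt (m.density (θ + h) x)
      - Real.sqrt (m.density (θ + h') x) - g h' (h - h') x)]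
    · exact (hunif h h' hh hh').2
    · filter_upwards [Lp.coeFn_sub (F h - F h') (D h' (h - h')), Lp.coeFn_sub (F h) (F h'), hF h hh,
        hF h' hh', hD h' hh' (h - h')] with x h₁ h₂ h₃ h₄ h₅
      rw [h₁, Pi.sub_apply, h₂, Pi.sub_apply, h₃, h₄, h₅]
  obtain ⟨C, hC, hlip⟩ := exists_lipschitz_of_uniform_expansion hexp
  refine ⟨C ^ 2, δ / 2, by linarith, fun h h' hh hh' => ?_⟩
  have hnorm := hlip h h' hh hh'
  have : m.hellingerSq (θ + h) (θ + h') = ‖F h - F h'‖ ^ 2 := by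
    rw [L2.norm_sq_eq_integral_sq (g := fun x => Real.sqrt (m.density (θ + h) x)
      - Real.sqrt (m.density (θ + h') x)), hellingerSq]
    filter_upwards [Lp.coeFn_sub (F h) (F h'), hF h (by linarith), hF h' (by linarith)]
      with x h₂ h₃ h₄
    rw [h₂, Pi.sub_apply, h₃, h₄]
  rw [this, ← mul_pow]
  exact pow_le_pow_left₀ (norm_nonneg _) hnorm 2

end DominatedModel

end HellingerBounds

/-! ### Approximating sequences from the Hausdorff distance -/

theorem CEquivalentAt.symm {k : ℕ} {c : ℝ} {A B : Set (EuclideanSpace ℝ (Fin k))}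
    {θ : EuclideanSpace ℝ (Fin k)} (h : CEquivalentAt c A B θ) : CEquivalentAt c B A θ :=
  ⟨h.1.symm, by simpa only [Metric.hausdorffDist_comm] using h.2⟩

theorem CNearEquivalentAt.symm {k : ℕ} {c : ℝ} {A B : Set (EuclideanSpace ℝ (Fin k))}
    {θ : EuclideanSpace ℝ (Fin k)} (h : CNearEquivalentAt c A B θ) : CNearEquivalentAt c B A θ :=
  ⟨h.1.symm, by simpa only [Metric.hausdorffDist_comm] using h.2⟩

theorem CEquivalentAt.isLittleO {k : ℕ} {c : ℝ} {A B : Set (EuclideanSpace ℝ (Fin k))}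
    {θ : EuclideanSpace ℝ (Fin k)} (h : CEquivalentAt c A B θ) :
    (fun ε : ℝ => Metric.hausdorffDist (A ∩ Metric.ball θ ε) (B ∩ Metric.ball θ ε))
      =o[𝓝[>] 0] fun ε : ℝ => ε ^ c := by
  have hpos : ∀ᶠ ε : ℝ in 𝓝[>] 0, 0 < ε := self_mem_nhdsWithin
  rw [isLittleO_iff_tendsto' (hpos.mono fun ε hε h0 => absurd h0 (Real.rpow_pos_of_pos hε c).ne')]
  refine h.2.congr' (hpos.mono fun ε hε => ?_)
  rw [Real.rpow_neg hε.le]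
  exact (div_eq_inv_mul _ _).symm

/-- Approximation of a sequence in `A` by one in `B` up to the Hausdorff distance of the traces of
`A` and `B` on shrinking balls. -/
theorem exists_seq_isLittleO_of_hausdorffDist {E : Type*} [NormedAddCommGroup E] {A B : Set E}
    {θ : E} (hA : θ ∈ A) (hB : θ ∈ B) {h : ℕ → E} (hh : ∀ n, θ + h n ∈ A) {ε φ : ℕ → ℝ}
    (hε : ∀ᶠ n in atTop, ‖h n‖ < ε n) (hφ : ∀ᶠ n in atTop, 0 < φ n)
    (hD : (fun n => Metric.hausdorffDist (A ∩ Metric.ball θ (ε n)) (B ∩ Metric.ball θ (ε n)))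
      =o[atTop] φ) :
    ∃ h' : ℕ → E, (∀ n, θ + h' n ∈ B) ∧ h' =O[atTop] ε ∧ (fun n => h n - h' n) =o[atTop] φ := by
  set D := fun n => Metric.hausdorffDist (A ∩ Metric.ball θ (ε n)) (B ∩ Metric.ball θ (ε n))
  -- The slack `φ n / (n + 1)` makes the inequality strict, as the distance need not be attained,
  -- and is still `o(φ)`. At the finitely many bad indices the default is `v = 0`, that is, the
  -- point `θ ∈ B`.
  have hex : ∀ n, ∃ v : E, θ + v ∈ B ∧ (‖h n‖ < ε n → 0 < φ n →
      ‖v‖ < ε n ∧ ‖h n - v‖ < D n + 1 / ((n : ℝ) + 1) * φ n) := by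
    intro n
    by_cases hn : ‖h n‖ < ε n ∧ 0 < φ n
    · have hε0 : 0 < ε n := (norm_nonneg _).trans_lt hn.1
      have hlt : D n < D n + 1 / ((n : ℝ) + 1) * φ n :=
        lt_add_of_pos_right _ (mul_pos Nat.one_div_pos_of_nat hn.2)
      obtain ⟨y, ⟨hyB, hyε⟩, hy⟩ := Metric.exists_dist_lt_of_hausdorffDist_lt
        (show θ + h n ∈ A ∩ Metric.ball θ (ε n) from ⟨hh n, by simpa using hn.1⟩) hlt
        (Metric.hausdorffEDist_ne_top_of_nonempty_of_bounded
          ⟨θ, hA, Metric.mem_ball_self hε0⟩ ⟨θ, hB, Metric.mem_ball_self hε0⟩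
          (Metric.isBounded_ball.subset Set.inter_subset_right)
          (Metric.isBounded_ball.subset Set.inter_subset_right))
      refine ⟨y - θ, by rwa [add_sub_cancel], fun _ _ => ⟨by simpa [dist_eq_norm] using hyε, ?_⟩⟩
      rwa [show h n - (y - θ) = θ + h n - y by abel, ← dist_eq_norm]
    · exact ⟨0, by simpa using hB, fun h₁ h₂ => absurd ⟨h₁, h₂⟩ hn⟩
  choose h' hB' hh' using hex
  refine ⟨h', hB', ?_, ?_⟩
  · refine IsBigO.of_bound 1 ?_
    filter_upwards [hε, hφ] with n h₁ h₂
    rw [one_mul]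
    exact ((hh' n h₁ h₂).1.le).trans (le_abs_self _)
  · have hη : (fun n : ℕ => 1 / ((n : ℝ) + 1) * φ n) =o[atTop] φ := by
      have : (fun n : ℕ => 1 / ((n : ℝ) + 1)) =o[atTop] fun _ => (1 : ℝ) :=
        (isLittleO_one_iff ℝ).2 tendsto_one_div_add_atTop_nhds_zero_nat
      simpa using this.mul_isBigO (isBigO_refl φ atTop)
    refine IsBigO.trans_isLittleO (IsBigO.of_bound 1 ?_) (hD.add hη)
    filter_upwards [hε, hφ] with n h₁ h₂
    rw [one_mul]
    exact ((hh' n h₁ h₂).2.le).trans (le_abs_self _)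

theorem CEquivalentAt.exists_seq {k : ℕ} {c : ℝ} (hc : 0 < c)
    {A B : Set (EuclideanSpace ℝ (Fin k))} {θ : EuclideanSpace ℝ (Fin k)}
    (hAB : CEquivalentAt c A B θ) {r : ℕ → ℝ} (hr : ∀ᶠ n in atTop, 0 < r n)
    (hr0 : Tendsto r atTop (𝓝 0)) {h : ℕ → EuclideanSpace ℝ (Fin k)} (hh : ∀ n, θ + h n ∈ A)
    (hhr : h =O[atTop] r) :
    ∃ h' : ℕ → EuclideanSpace ℝ (Fin k), (∀ n, θ + h' n ∈ B) ∧ h' =O[atTop] r ∧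
      (fun n => h n - h' n) =o[atTop] fun n => r n ^ c := by
  -- Adding `r n` makes the radius positive and larger than `‖h n‖` while keeping it `O(r)`.
  set ε : ℕ → ℝ := fun n => ‖h n‖ + r n with hεdef
  have hεr : ε =O[atTop] r := hhr.norm_left.add (isBigO_refl r atTop)
  have hε : ∀ᶠ n in atTop, ‖h n‖ < ε n := hr.mono fun n hn => lt_add_of_pos_right _ hn
  have hε0 : Tendsto ε atTop (𝓝[>] 0) := tendsto_nhdsWithin_iff.2
    ⟨hεr.trans_tendsto hr0, hε.mono fun n hn => (norm_nonneg _).trans_lt hn⟩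
  obtain ⟨h', h₁, h₂, h₃⟩ := exists_seq_isLittleO_of_hausdorffDist hAB.1.1 hAB.1.2 hh hε
    (hr.mono fun n hn => Real.rpow_pos_of_pos hn c)
    ((hAB.isLittleO.comp_tendsto hε0).trans_isBigO
      (hεr.rpow hc.le (hr.mono fun n hn => hn.le)))
  exact ⟨h', h₁, h₂.trans hεr, h₃⟩

theorem CNearEquivalentAt.exists_seq {k : ℕ} {c : ℝ} (hc : 0 < c)
    {A B : Set (EuclideanSpace ℝ (Fin k))} {θ : EuclideanSpace ℝ (Fin k)}
    (hAB : CNearEquivalentAt c A B θ) {r : ℕ → ℝ} (hr : ∀ᶠ n in atTop, 0 < r n)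
    (hr0 : Tendsto r atTop (𝓝 0)) {h : ℕ → EuclideanSpace ℝ (Fin k)} (hh : ∀ n, θ + h n ∈ A)
    (hhr : h =o[atTop] r) :
    ∃ h' : ℕ → EuclideanSpace ℝ (Fin k), (∀ n, θ + h' n ∈ B) ∧ h' =o[atTop] r ∧
      (fun n => h n - h' n) =o[atTop] fun n => r n ^ c := by
  -- The factor `1 / (n + 1)` keeps the radius `o(r)`, so that `O(ε^c)` becomes `o(r^c)`.
  set ε : ℕ → ℝ := fun n => ‖h n‖ + 1 / ((n : ℝ) + 1) * r n with hεdef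
  have hη : (fun n : ℕ => 1 / ((n : ℝ) + 1) * r n) =o[atTop] r := by
    have : (fun n : ℕ => 1 / ((n : ℝ) + 1)) =o[atTop] fun _ => (1 : ℝ) :=
      (isLittleO_one_iff ℝ).2 tendsto_one_div_add_atTop_nhds_zero_nat
    simpa using this.mul_isBigO (isBigO_refl r atTop)
  have hεr : ε =o[atTop] r := hhr.norm_left.add hη
  have hε : ∀ᶠ n in atTop, ‖h n‖ < ε n := hr.mono fun n hn =>
    lt_add_of_pos_right _ (mul_pos Nat.one_div_pos_of_nat hn)
  have hε0 : Tendsto ε atTop (𝓝[>] 0) := tendsto_nhdsWithin_iff.2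
    ⟨hεr.isBigO.trans_tendsto hr0, hε.mono fun n hn => (norm_nonneg _).trans_lt hn⟩
  obtain ⟨h', h₁, h₂, h₃⟩ := exists_seq_isLittleO_of_hausdorffDist hAB.1.1 hAB.1.2 hh hε
    (hr.mono fun n hn => Real.rpow_pos_of_pos hn c)
    ((hAB.2.comp_tendsto hε0).trans_isLittleO
      (hεr.rpow hc (hr.mono fun n hn => hn.le)))
  exact ⟨h', h₁, h₂.trans_isLittleO hεr, h₃⟩

/-! ### Tangency and second-order contact of submanifolds -/

/-- Near a zero at which the derivative is onto, the distance to the zero set is bounded by a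
multiple of the value of the map. -/
theorem HasStrictFDerivAt.exists_zero_near {E F : Type*} [NormedAddCommGroup E] [NormedSpace ℝ E]
    [CompleteSpace E] [NormedAddCommGroup F] [NormedSpace ℝ F] [CompleteSpace F] {f : E → F}
    {f' : E →L[ℝ] F} {a : E} (hf : HasStrictFDerivAt f f' a) (hsurj : Function.Surjective f')
    (ha : f a = 0) {U : Set E} (hU : U ∈ 𝓝 a) :
    ∃ K : ℝ, 0 ≤ K ∧ ∀ᶠ x in 𝓝 a, ∃ y ∈ U, f y = 0 ∧ ‖x - y‖ ≤ K * ‖f x‖ := by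
  have hrange : (f' : E →ₗ[ℝ] F).range = ⊤ := LinearMap.range_eq_top.2 hsurj
  set N := f'.nonlinearRightInverseOfSurjective hrange
  have hN : 0 < N.nnnorm := f'.nonlinearRightInverseOfSurjective_nnnorm_pos hrange
  have hN' : (0 : ℝ) < N.nnnorm := hN
  -- With error constant `N⁻¹ / 2`, the ball of radius `2 N ‖f x‖` about `x` is mapped over the ball
  -- of radius `‖f x‖` about `f x`, which just reaches 0.
  obtain ⟨s, hs, happ⟩ := hf.approximates_deriv_on_nhds (c := N.nnnorm⁻¹ / 2)
    (Or.inr (half_pos (inv_pos.2 hN)))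
  obtain ⟨ρ, hρ, hball⟩ := Metric.mem_nhds_iff.1 (inter_mem hs hU)
  refine ⟨2 * N.nnnorm, by positivity, ?_⟩
  have hcont : Tendsto (fun x => 2 * (N.nnnorm : ℝ) * ‖f x‖) (𝓝 a) (𝓝 0) := by
    simpa [ha] using (hf.continuousAt.norm.const_mul (2 * (N.nnnorm : ℝ))).tendsto
  filter_upwards [Metric.ball_mem_nhds a (half_pos hρ),
    hcont.eventually (eventually_lt_nhds (half_pos hρ))] with x hx hfx
  have hsub : Metric.closedBall x (2 * N.nnnorm * ‖f x‖) ⊆ s ∩ U := by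
    refine subset_trans (fun y hy => ?_) hball
    rw [Metric.mem_closedBall] at hy
    rw [Metric.mem_ball] at hx ⊢
    linarith [dist_triangle y x a]
  have hsur := happ.surjOn_closedBall_of_nonlinearRightInverse N (by positivity)
    (hsub.trans Set.inter_subset_left)
  obtain ⟨y, hy, hfy⟩ := hsur (a := 0) (by
    rw [Metric.mem_closedBall, dist_zero_left]
    push_cast
    refine le_of_eq ?_
    field_simp
    ring)
  exact ⟨y, (hsub hy).2, hfy, by rwa [← dist_eq_norm, dist_comm]⟩

/-- The derivative is Lipschitz near `a`, so on the ball of radius `‖x - a‖` it differs from its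
value at `a` by at most `K ‖x - a‖`; the mean value inequality gives the second factor. -/
theorem ContDiffAt.isBigO_sub_sub_fderiv {E F : Type*} [NormedAddCommGroup E] [NormedSpace ℝ E]
    [NormedAddCommGroup F] [NormedSpace ℝ F] {f : E → F} {a : E} (hf : ContDiffAt ℝ 2 f a) :
    (fun x => f x - f a - fderiv ℝ f a (x - a)) =O[𝓝 a] fun x => ‖x - a‖ ^ 2 := by
  obtain ⟨K, t, ht, hK⟩ := (hf.fderiv_right (m := 1) (by norm_num)).exists_lipschitzOnWith
  have hdiff : ∀ᶠ x in 𝓝 a, DifferentiableAt ℝ f x :=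
    (hf.eventually (by simp)).mono fun x hx => hx.differentiableAt (by norm_num)
  obtain ⟨ρ, hρ, hball⟩ := Metric.mem_nhds_iff.1 (inter_mem ht hdiff)
  refine IsBigO.of_bound K ?_
  filter_upwards [Metric.ball_mem_nhds a hρ] with x hx
  have hsub : Metric.closedBall a ‖x - a‖ ⊆ t ∩ {x | DifferentiableAt ℝ f x} := by
    refine subset_trans (Metric.closedBall_subset_ball ?_) hball
    rwa [← dist_eq_norm]
  have hself : a ∈ Metric.closedBall a ‖x - a‖ := Metric.mem_closedBall_self (norm_nonneg _)
  have := Convex.norm_image_sub_le_of_norm_fderiv_le' (𝕜 := ℝ) (f := f) (x := a) (y := x)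
    (φ := fderiv ℝ f a) (C := K * ‖x - a‖) (s := Metric.closedBall a ‖x - a‖)
    (fun y hy => (hsub hy).2) (fun y hy => by
      refine (hK.norm_sub_le (hsub hy).1 (hsub hself).1).trans ?_
      gcongr
      rwa [← dist_eq_norm]) (convex_closedBall _ _) hself
    (by rw [Metric.mem_closedBall, dist_eq_norm])
  refine this.trans (le_of_eq ?_)
  rw [Real.norm_of_nonneg (sq_nonneg _)]
  ring

theorem IsC2SubmanifoldAt.exists_defining {k : ℕ} {A : Set (EuclideanSpace ℝ (Fin k))}
    {θ : EuclideanSpace ℝ (Fin k)} (hA : IsC2SubmanifoldAt A θ) :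
    ∃ (q : ℕ) (g : EuclideanSpace ℝ (Fin k) → EuclideanSpace ℝ (Fin q)), ContDiffAt ℝ 2 g θ ∧
      Function.Surjective (fderiv ℝ g θ) ∧ g θ = 0 ∧ ∀ᶠ x in 𝓝 θ, x ∈ A ↔ g x = 0 := by
  obtain ⟨hθA, q, U, g, hU, hθU, hg, hsurj, hAU⟩ := hA
  have hmem : ∀ x ∈ U, (x ∈ A ↔ g x = 0) := fun x hx =>
    ⟨fun hxA => (hAU.subset ⟨hxA, hx⟩).2, fun hx0 => (hAU.superset ⟨hx, hx0⟩).1⟩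
  exact ⟨q, g, hg.contDiffAt (hU.mem_nhds hθU), hsurj, (hmem θ hθU).1 hθA,
    eventually_of_mem (hU.mem_nhds hθU) hmem⟩

/-- The tangent space of `A` is contained in that of a submanifold `B` which is `1`-equivalent
to it. -/
theorem CEquivalentAt.fderiv_eq_zero {k p q : ℕ} {A B : Set (EuclideanSpace ℝ (Fin k))}
    {θ : EuclideanSpace ℝ (Fin k)} (hAB : CEquivalentAt 1 A B θ)
    {g : EuclideanSpace ℝ (Fin k) → EuclideanSpace ℝ (Fin p)}
    {f : EuclideanSpace ℝ (Fin k) → EuclideanSpace ℝ (Fin q)}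
    (hg : ContDiffAt ℝ 2 g θ) (hgsurj : Function.Surjective (fderiv ℝ g θ)) (hg0 : g θ = 0)
    (hA : ∀ᶠ x in 𝓝 θ, x ∈ A ↔ g x = 0)
    (hf : DifferentiableAt ℝ f θ) (hf0 : f θ = 0) (hB : ∀ᶠ x in 𝓝 θ, x ∈ B ↔ f x = 0)
    {t : EuclideanSpace ℝ (Fin k)} (ht : fderiv ℝ g θ t = 0) : fderiv ℝ f θ t = 0 := by
  -- Walk along `θ + r n • t`. Being tangent to `A`, it is within `o(r)` of points of `A`, hence, by
  -- 1-equivalence, of points `θ + h' n` of `B`. There `f` vanishes, so `f'(h' n) = o(r)`, so `f'(r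
  -- n • t) = o(r)`; dividing by `r n` gives `f'(t) = 0`.
  set r : ℕ → ℝ := fun n => 1 / ((n : ℝ) + 1) with hr
  have hrpos : ∀ n, 0 < r n := fun n => Nat.one_div_pos_of_nat
  have hr0 : Tendsto r atTop (𝓝 0) := tendsto_one_div_add_atTop_nhds_zero_nat
  have hrt : (fun n => r n • t) =O[atTop] r := by
    refine IsBigO.of_bound ‖t‖ (Eventually.of_forall fun n => ?_)
    rw [norm_smul, mul_comm]
  have hx : Tendsto (fun n => θ + r n • t) atTop (𝓝 θ) := by
    simpa using (hrt.trans_tendsto hr0).const_add θ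
  obtain ⟨K, -, hK⟩ := (hg.hasStrictFDerivAt (by norm_num)).exists_zero_near hgsurj hg0 hA
  have hex : ∀ n, ∃ y ∈ A, (∃ y ∈ {x | x ∈ A ↔ g x = 0}, g y = 0 ∧
      ‖θ + r n • t - y‖ ≤ K * ‖g (θ + r n • t)‖) → ‖θ + r n • t - y‖ ≤ K * ‖g (θ + r n • t)‖ := by
    intro n
    by_cases hn : ∃ y ∈ {x | x ∈ A ↔ g x = 0}, g y = 0 ∧
      ‖θ + r n • t - y‖ ≤ K * ‖g (θ + r n • t)‖
    · obtain ⟨y, hy, hy0, hyn⟩ := hn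
      exact ⟨y, hy.2 hy0, fun _ => hyn⟩
    · exact ⟨θ, hAB.1.1, fun h => absurd h hn⟩
  choose y hyA hy using hex
  have hgx : (fun n => g (θ + r n • t)) =o[atTop] r := by
    have h₁ := (hg.differentiableAt (by norm_num)).hasFDerivAt.isLittleO.comp_tendsto hx
    refine (h₁.congr (fun n => ?_) fun n => ?_).trans_isBigO hrt
    · simp [hg0, ht]
    · simp
  have hxy : (fun n => θ + r n • t - y n) =o[atTop] r := by
    refine IsBigO.trans_isLittleO (IsBigO.of_bound K ?_) hgx
    filter_upwards [hx.eventually hK] with n hn using hy n hn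
  have hy' : (fun n => y n - θ) =O[atTop] r :=
    (hrt.sub hxy.isBigO).congr_left fun n => by abel
  obtain ⟨h', h₁, h₂, h₃⟩ := hAB.exists_seq one_pos (Eventually.of_forall hrpos) hr0
    (h := fun n => y n - θ) (fun n => by rw [add_sub_cancel]; exact hyA n) hy'
  simp only [Real.rpow_one] at h₃
  have hh' : Tendsto (fun n => θ + h' n) atTop (𝓝 θ) := by
    simpa using (h₂.trans_tendsto hr0).const_add θ
  have hfh : (fun n => fderiv ℝ f θ (h' n)) =o[atTop] r := by
    have h₄ := hf.hasFDerivAt.isLittleO.comp_tendsto hh'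
    refine (h₄.neg_left.congr' ?_ ?_).trans_isBigO h₂
    · filter_upwards [hh'.eventually hB] with n hn
      simp [hf0, hn.1 (h₁ n)]
    · exact Eventually.of_forall fun n => by simp
  have hdiff : (fun n => r n • t - h' n) =o[atTop] r :=
    (hxy.add h₃).congr_left fun n => by abel
  have hfd : (fun n => fderiv ℝ f θ (r n • t)) =o[atTop] r := by
    refine (hfh.add (((fderiv ℝ f θ).isBigO_comp _ _).trans_isLittleO hdiff)).congr_left
      fun n => ?_
    rw [← map_add, add_sub_cancel]
  have hlim : Tendsto (fun n => (r n)⁻¹ • fderiv ℝ f θ (r n • t)) atTop (𝓝 0) :=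
    hfd.tendsto_inv_smul_nhds_zero
  refine tendsto_nhds_unique (tendsto_const_nhds.congr fun n => ?_) hlim
  rw [map_smul, inv_smul_smul₀ (hrpos n).ne']

/-- Two `1`-equivalent `C²` submanifolds approximate each other to second order. -/
theorem CEquivalentAt.exists_seq_isBigO_sq {k : ℕ} {A B : Set (EuclideanSpace ℝ (Fin k))}
    {θ : EuclideanSpace ℝ (Fin k)} (hAB : CEquivalentAt 1 A B θ) (hA : IsC2SubmanifoldAt A θ)
    (hB : IsC2SubmanifoldAt B θ) {h : ℕ → EuclideanSpace ℝ (Fin k)}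
    (hh : Tendsto h atTop (𝓝 0)) (hhA : ∀ n, θ + h n ∈ A) :
    ∃ h' : ℕ → EuclideanSpace ℝ (Fin k), (∀ n, θ + h' n ∈ B) ∧
      (fun n => h n - h' n) =O[atTop] fun n => ‖h n‖ ^ 2 := by
  obtain ⟨p, g, hg, hgsurj, hg0, hgA⟩ := hA.exists_defining
  obtain ⟨q, f, hf, hfsurj, hf0, hfB⟩ := hB.exists_defining
  have hx : Tendsto (fun n => θ + h n) atTop (𝓝 θ) := by simpa using hh.const_add θ
  have hker : ∀ t, fderiv ℝ g θ t = 0 → fderiv ℝ f θ t = 0 := fun t =>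
    hAB.fderiv_eq_zero hg hgsurj hg0 hgA (hf.differentiableAt (by norm_num)) hf0 hfB
  have hgh : (fun n => fderiv ℝ g θ (h n)) =O[atTop] fun n => ‖h n‖ ^ 2 := by
    refine (hg.isBigO_sub_sub_fderiv.comp_tendsto hx).neg_left.congr' ?_ ?_
    · filter_upwards [hx.eventually hgA] with n hn
      simp [hg0, hn.1 (hhA n)]
    · exact Eventually.of_forall fun n => by simp
  -- Since `ker g' ⊆ ker f'`, the value `f'(h)` depends only on `g'(h)`: replace `h` by `N (g' h)`,
  -- with `N` a bounded right inverse of `g'`.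
  have hfh : (fun n => fderiv ℝ f θ (h n)) =O[atTop] fun n => ‖h n‖ ^ 2 := by
    set N := (fderiv ℝ g θ).nonlinearRightInverseOfSurjective (LinearMap.range_eq_top.2 hgsurj)
    refine IsBigO.trans (IsBigO.of_bound (‖fderiv ℝ f θ‖ * N.nnnorm)
      (Eventually.of_forall fun n => ?_)) hgh
    have : fderiv ℝ f θ (h n) = fderiv ℝ f θ (N (fderiv ℝ g θ (h n))) := by
      rw [← sub_eq_zero, ← map_sub]
      refine hker _ ?_
      rw [map_sub, N.right_inv, sub_self]
    rw [this, mul_assoc]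
    exact ((fderiv ℝ f θ).le_opNorm _).trans (by gcongr; exact N.bound _)
  have hfx : (fun n => f (θ + h n)) =O[atTop] fun n => ‖h n‖ ^ 2 := by
    have h₁ : (fun n => f (θ + h n) - f θ - fderiv ℝ f θ (h n)) =O[atTop] fun n => ‖h n‖ ^ 2 := by
      refine (hf.isBigO_sub_sub_fderiv.comp_tendsto hx).congr (fun n => ?_) fun n => ?_ <;> simp
    refine (h₁.add hfh).congr_left fun n => ?_
    rw [hf0]
    abel
  obtain ⟨K, -, hK⟩ := (hf.hasStrictFDerivAt (by norm_num)).exists_zero_near hfsurj hf0 hfB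
  have hex : ∀ n, ∃ v, θ + v ∈ B ∧ ((∃ y ∈ {x | x ∈ B ↔ f x = 0}, f y = 0 ∧
      ‖θ + h n - y‖ ≤ K * ‖f (θ + h n)‖) → ‖h n - v‖ ≤ K * ‖f (θ + h n)‖) := by
    intro n
    by_cases hn : ∃ y ∈ {x | x ∈ B ↔ f x = 0}, f y = 0 ∧
      ‖θ + h n - y‖ ≤ K * ‖f (θ + h n)‖
    · obtain ⟨y, hy, hy0, hyn⟩ := hn
      refine ⟨y - θ, by rw [add_sub_cancel]; exact hy.2 hy0, fun _ => ?_⟩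
      rwa [show h n - (y - θ) = θ + h n - y by abel]
    · exact ⟨0, by simpa using hAB.1.2, fun h => absurd h hn⟩
  choose h' hB' hh' using hex
  refine ⟨h', hB', IsBigO.trans (IsBigO.of_bound K ?_) hfx⟩
  filter_upwards [hx.eventually hK] with n hn using hh' n hn

/-! ### From parameter distances to indistinguishable local alternatives -/

namespace DominatedModel

variable {k : ℕ} {X : Type*} [MeasurableSpace X]

/-- Local alternatives which differ by `o(n^{-1/2})` are asymptotically indistinguishable. -/
theorem DDQMAt.asympIndistinguishable {m : DominatedModel k X} {θ : EuclideanSpace ℝ (Fin k)}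
    (hθ : m.DDQMAt θ) {h h' : ℕ → EuclideanSpace ℝ (Fin k)} (hh : Tendsto h atTop (𝓝 0))
    (hΘ : ∀ n, θ + h n ∈ m.Θ) (hΘ' : ∀ n, θ + h' n ∈ m.Θ)
    (hsub : (fun n => h n - h' n) =o[atTop] fun n : ℕ => (n : ℝ) ^ (-(1 / 2 : ℝ))) :
    m.AsympIndistinguishable (fun n => θ + h n) fun n => θ + h' n := by
  have hhalf : Tendsto (fun n : ℕ => (n : ℝ) ^ (-(1 / 2 : ℝ))) atTop (𝓝 0) :=
    (tendsto_rpow_neg_atTop (by norm_num)).comp tendsto_natCast_atTop_atTop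
  have hh' : Tendsto h' atTop (𝓝 0) := by
    simpa using hh.sub (hsub.isBigO.trans_tendsto hhalf)
  obtain ⟨C, δ, hδ, hC⟩ := hθ.exists_hellingerSq_le
  have hsmall : ∀ u : ℕ → EuclideanSpace ℝ (Fin k), Tendsto u atTop (𝓝 0) →
      ∀ᶠ n in atTop, ‖u n‖ < δ := fun u hu =>
    hu.norm.eventually (eventually_lt_nhds (by simpa using hδ))
  refine m.asympIndistinguishable_of_hellingerSq hΘ hΘ' ?_
  have hsq : (fun n => ‖h n - h' n‖ ^ 2) =o[atTop] fun n : ℕ => ((n : ℝ) ^ (-(1 / 2 : ℝ))) ^ 2 :=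
    hsub.norm_left.pow two_pos
  have hn : Tendsto (fun n : ℕ => (n : ℝ) * (C * ‖h n - h' n‖ ^ 2)) atTop (𝓝 0) := by
    rw [← isLittleO_one_iff ℝ]
    refine ((isBigO_refl (fun n : ℕ => (n : ℝ)) atTop).mul_isLittleO
      (hsq.const_mul_left C)).trans_isBigO (IsBigO.of_bound 1 (Eventually.of_forall fun n => ?_))
    have hpow : ((n : ℝ) ^ (-(1 / 2 : ℝ))) ^ 2 = (n : ℝ)⁻¹ := by
      rw [← Real.rpow_natCast, ← Real.rpow_mul (Nat.cast_nonneg n), ← Real.rpow_neg_one]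
      norm_num
    rw [hpow, norm_one, one_mul, Real.norm_of_nonneg (by positivity)]
    exact mul_inv_le_one
  refine squeeze_zero' (Eventually.of_forall fun n =>
    mul_nonneg (Nat.cast_nonneg n) (m.hellingerSq_nonneg _ _)) ?_ hn
  filter_upwards [hsmall h hh, hsmall h' hh'] with n h₁ h₂
  gcongr
  exact hC _ _ h₁ h₂

variable {m : DominatedModel k X} {θ : EuclideanSpace ℝ (Fin k)}
  {A B : Set (EuclideanSpace ℝ (Fin k))}

theorem tendsto_natCast_rpow_neg {a : ℝ} (ha : 0 < a) :
    Tendsto (fun n : ℕ => (n : ℝ) ^ (-a)) atTop (𝓝 0) :=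
  (tendsto_rpow_neg_atTop ha).comp tendsto_natCast_atTop_atTop

theorem eventually_natCast_rpow_pos (a : ℝ) : ∀ᶠ n : ℕ in atTop, 0 < (n : ℝ) ^ a :=
  (eventually_gt_atTop 0).mono fun _ hn => Real.rpow_pos_of_pos (Nat.cast_pos.2 hn) a

theorem natCast_rpow_rpow_eq {c : ℝ} (hc : 0 < c) (n : ℕ) :
    ((n : ℝ) ^ (-(1 / (2 * c)))) ^ c = (n : ℝ) ^ (-(1 / 2 : ℝ)) := by
  rw [← Real.rpow_mul (Nat.cast_nonneg n)]
  congr 1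
  field_simp

theorem locallyMimicked_of_cEquivalentAt (hθ : m.DDQMAt θ) (hA : A ⊆ m.Θ) (hB : B ⊆ m.Θ) {c : ℝ}
    (hc : 0 < c) (hAB : CEquivalentAt c A B θ) :
    m.LocallyMimicked A B θ
      (fun h => h =O[atTop] fun n : ℕ => (n : ℝ) ^ (-(1 / (2 * c)))) := by
  intro h hh hhA
  have hr0 := tendsto_natCast_rpow_neg (show 0 < 1 / (2 * c) by positivity)
  obtain ⟨h', h₁, h₂, h₃⟩ := hAB.exists_seq hc (eventually_natCast_rpow_pos _) hr0 hhA hh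
  simp only [natCast_rpow_rpow_eq hc] at h₃
  exact ⟨h', h₂, h₁, hθ.asympIndistinguishable (hh.trans_tendsto hr0) (fun n => hA (hhA n))
    (fun n => hB (h₁ n)) h₃⟩

theorem locallyMimicked_of_cNearEquivalentAt (hθ : m.DDQMAt θ) (hA : A ⊆ m.Θ) (hB : B ⊆ m.Θ)
    {c : ℝ} (hc : 0 < c) (hAB : CNearEquivalentAt c A B θ) :
    m.LocallyMimicked A B θ
      (fun h => h =o[atTop] fun n : ℕ => (n : ℝ) ^ (-(1 / (2 * c)))) := by
  intro h hh hhA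
  have hr0 := tendsto_natCast_rpow_neg (show 0 < 1 / (2 * c) by positivity)
  obtain ⟨h', h₁, h₂, h₃⟩ := hAB.exists_seq hc (eventually_natCast_rpow_pos _) hr0 hhA hh
  simp only [natCast_rpow_rpow_eq hc] at h₃
  exact ⟨h', h₂, h₁, hθ.asympIndistinguishable (hh.isBigO.trans_tendsto hr0)
    (fun n => hA (hhA n)) (fun n => hB (h₁ n)) h₃⟩

theorem locallyMimicked_of_isC2SubmanifoldAt (hθ : m.DDQMAt θ) (hA : A ⊆ m.Θ) (hB : B ⊆ m.Θ)
    (hA₂ : IsC2SubmanifoldAt A θ) (hB₂ : IsC2SubmanifoldAt B θ) (hAB : CEquivalentAt 1 A B θ) :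
    m.LocallyMimicked A B θ (fun h => h =o[atTop] fun n : ℕ => (n : ℝ) ^ (-(1 / 4 : ℝ))) := by
  intro h hh hhA
  have hr0 := tendsto_natCast_rpow_neg (show (0 : ℝ) < 1 / 4 by norm_num)
  have hh0 : Tendsto h atTop (𝓝 0) := hh.isBigO.trans_tendsto hr0
  obtain ⟨h', h₁, h₂⟩ := hAB.exists_seq_isBigO_sq hA₂ hB₂ hh0 hhA
  -- The quadratic gap turns `o(n^{-1/4})` into `o(n^{-1/2})`; 1-equivalence alone would only serve
  -- alternatives of order `O(n^{-1/2})`.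
  have hsub : (fun n => h n - h' n) =o[atTop] fun n : ℕ => (n : ℝ) ^ (-(1 / 2 : ℝ)) := by
    refine h₂.trans_isLittleO ((hh.norm_left.pow two_pos).congr_right fun n => ?_)
    rw [← Real.rpow_natCast, ← Real.rpow_mul (Nat.cast_nonneg n)]
    norm_num
  have hle : (fun n : ℕ => (n : ℝ) ^ (-(1 / 2 : ℝ))) =O[atTop]
      fun n : ℕ => (n : ℝ) ^ (-(1 / 4 : ℝ)) := by
    refine IsBigO.of_bound 1 ((eventually_ge_atTop 1).mono fun n hn => ?_)
    rw [one_mul, Real.norm_of_nonneg (by positivity), Real.norm_of_nonneg (by positivity)]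
    exact Real.rpow_le_rpow_of_exponent_le (by exact_mod_cast hn) (by norm_num)
  exact ⟨h', (hh.sub (hsub.trans_isBigO hle)).congr_left fun n => sub_sub_cancel _ _, h₁,
    hθ.asympIndistinguishable hh0 (fun n => hA (hhA n)) (fun n => hB (h₁ n)) hsub⟩

end DominatedModel

theorem mainTheorem4 {k : ℕ} {X : Type*} [MeasurableSpace X] (m : DominatedModel k X)
    (θ : EuclideanSpace ℝ (Fin k)) (hθ : m.DDQMAt θ)
    (M₁ M₂ : Set (EuclideanSpace ℝ (Fin k))) (hM₁ : M₁ ⊆ m.Θ) (hM₂ : M₂ ⊆ m.Θ) :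
    (∀ c : ℝ, 0 < c → CEquivalentAt c M₁ M₂ θ →
      m.CannotDistinguish M₁ M₂ θ
        (fun h => h =O[atTop] fun n : ℕ => (n : ℝ) ^ (-(1 / (2 * c))))) ∧
    (∀ c : ℝ, 0 < c → CNearEquivalentAt c M₁ M₂ θ →
      m.CannotDistinguish M₁ M₂ θ
        (fun h => h =o[atTop] fun n : ℕ => (n : ℝ) ^ (-(1 / (2 * c))))) ∧
    (IsC2SubmanifoldAt M₁ θ → IsC2SubmanifoldAt M₂ θ → CEquivalentAt 1 M₁ M₂ θ →
      m.CannotDistinguish M₁ M₂ θ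
        (fun h => h =o[atTop] fun n : ℕ => (n : ℝ) ^ (-(1 / 4 : ℝ)))) := by
  refine ⟨fun c hc h => ⟨?_, ?_⟩, fun c hc h => ⟨?_, ?_⟩, fun h₁ h₂ h => ⟨?_, ?_⟩⟩
  · exact DominatedModel.locallyMimicked_of_cEquivalentAt hθ hM₁ hM₂ hc h
  · exact DominatedModel.locallyMimicked_of_cEquivalentAt hθ hM₂ hM₁ hc h.symm
  · exact DominatedModel.locallyMimicked_of_cNearEquivalentAt hθ hM₁ hM₂ hc h
  · exact DominatedModel.locallyMimicked_of_cNearEquivalentAt hθ hM₂ hM₁ hc h.symm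
  · exact DominatedModel.locallyMimicked_of_isC2SubmanifoldAt hθ hM₁ hM₂ h₁ h₂ h
  · exact DominatedModel.locallyMimicked_of_isC2SubmanifoldAt hθ hM₂ hM₁ h₂ h₁ h.symm
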